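/- Let $X$ be an integral projective variety over $\mathbb{C}$ and let $L$, $M$ be line bundles on $X$. For a subspace $W\subseteq H^0(X,L)$ and an integer $p\ge 0$, let $K_{p,1}(X,L;W)$ denote the middle cohomology of the Koszul complex $$\bigwedge^{p+1}W\otimes H^0(X,\mathcal{O}_X)\to\bigwedge^{p}W\otimes H^0(X,L)\to\bigwedge^{p-1}W\otimes H^0(X,L^{\otimes 2}),$$ whose differentials are $(w_0\wedge\dots\wedge w_k)\otimes a\mapsto\sum_{i}(-1)^i\,(w_0\wedge\dots\wedge\widehat{w_i}\wedge\dots\wedge w_k)\otimes w_i a$ (with $\bigwedge^{-1}W=0$). Assume that $h^0(X,M)=2$, that $h^0(X,L\otimes M^\vee)=p+1$ for some $p\ge 0$, and that $L\otimes M^\vee$ is base-point free. Let $0\neq s\in H^0(X,M)$. Then multiplication by $s$ is an injection $H^0(X,L\otimes M^\vee)\to H^0(X,L)$, and, regarding $H^0(X,L\otimes M^\vee)$ as a subspace of $H^0(X,L)$ by means of it, there is a natural isomorphism $$\bigwedge^{p+1}H^0(X,L\otimes M^\vee)\otimes\frac{H^0(X,M)}{\mathbb{C}\langle s\rangle}\;\xrightarrow{\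 \sim\ }\;K_{p,1}\bigl(X,L;H^0(X,L\otimes M^\vee)\bigr),$$ which sends $(n_0\wedge\dots\wedge n_p)\otimes[m]$ to the class of the cycle $\sum_{i=0}^{p}(-1)^i\,(s n_0\wedge\dots\wedge\widehat{s n_i}\wedge\dots\wedge s n_p)\otimes n_i m$. In particular, $\dim K_{p,1}(X,L;H^0(X,L\otimes M^\vee))=1$. -/

import Mathlib

open CategoryTheory AlgebraicGeometry Opposite TopologicalSpace
open scoped TensorProduct

noncomputable section
namespace SyzygyBundles

variable {X : Scheme.{0}}

/-- The structure sheaf `𝒪_X`, as a module over itself. -/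
def structureSheaf (X : Scheme.{0}) : X.Modules := SheafOfModules.unit X.ringCatSheaf

/-- Restriction of sections of an `𝒪_X`-module. -/
def sectionRes (M : X.Modules) {V W : X.Opens} (h : W ≤ V) : Γ(M, V) →+ Γ(M, W) :=
  (M.presheaf.map (homOfLE h).op).hom

/-- Restriction of regular functions. -/
def functionRes {V W : X.Opens} (h : W ≤ V) : Γ(X, V) →+* Γ(X, W) :=
  (X.presheaf.map (homOfLE h).op).hom

lemma sectionRes_smul (M : X.Modules) {V W : X.Opens} (h : W ≤ V) (a : Γ(X, V)) (m : Γ(M, V)) :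
    sectionRes M h (a • m) = functionRes h a • sectionRes M h m :=
  Scheme.Modules.map_smul M (homOfLE h) a m

lemma sectionRes_sectionRes (M : X.Modules) {V W Z : X.Opens} (h : W ≤ V) (h' : Z ≤ W) (m : Γ(M, V)) :
    sectionRes M h' (sectionRes M h m) = sectionRes M (h'.trans h) m := by
  have := M.presheaf.map_comp (homOfLE h).op (homOfLE h').op
  exact (congr($(this).hom m)).symm

lemma functionRes_functionRes {V W Z : X.Opens} (h : W ≤ V) (h' : Z ≤ W) (a : Γ(X, V)) :
    functionRes h' (functionRes h a) = functionRes (h'.trans h) a := by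
  have := X.presheaf.map_comp (homOfLE h).op (homOfLE h').op
  exact (congr($(this).hom a)).symm

/-- The `𝒪_X(U)`-module `Hom(M|_U, N|_U)`: families of `𝒪_X(V)`-linear maps `M(V) → N(V)`, for
`V ⊆ U` open, that commute with restriction. -/
def homSections (M N : X.Modules) (U : X.Opens) :
    AddSubgroup (∀ V : {V : X.Opens // V ≤ U}, Γ(M, V.1) →ₗ[Γ(X, V.1)] Γ(N, V.1)) where
  carrier := {φ | ∀ (V W : {V : X.Opens // V ≤ U}) (h : W.1 ≤ V.1) (m : Γ(M, V.1)),
    φ W (sectionRes M h m) = sectionRes N h (φ V m)}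
  zero_mem' := fun V W h m => by simp
  add_mem' := fun {φ ψ} hφ hψ V W h m => by simp [hφ V W h m, hψ V W h m]
  neg_mem' := fun {φ} hφ V W h m => by simp [hφ V W h m]

instance (M N : X.Modules) (U : X.Opens) : SMul Γ(X, U) (homSections M N U) where
  smul a φ := ⟨fun V => functionRes V.2 a • φ.1 V, fun V W h m => by
    simp [sectionRes_smul, φ.2 V W h m, functionRes_functionRes]⟩

lemma homSections_smul_val (M N : X.Modules) (U : X.Opens) (a : Γ(X, U)) (φ : homSections M N U)
    (V : {V : X.Opens // V ≤ U}) : (a • φ).1 V = functionRes V.2 a • φ.1 V := rfl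

instance (M N : X.Modules) (U : X.Opens) : Module Γ(X, U) (homSections M N U) where
  one_smul φ := by ext V m; simp [homSections_smul_val]
  mul_smul a b φ := by ext V m; simp [homSections_smul_val, mul_smul]
  smul_zero a := by ext V m; simp [homSections_smul_val]
  smul_add a φ ψ := by ext V m; simp [homSections_smul_val]
  add_smul a b φ := by ext V m; simp [homSections_smul_val, add_smul]
  zero_smul φ := by ext V m; simp [homSections_smul_val]

/-- Restriction of a homomorphism `M|_U → N|_U` to a smaller open set. -/
def homRes (M N : X.Modules) {U U' : X.Opens} (h : U' ≤ U) :
    homSections M N U →+ homSections M N U' where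
  toFun φ := ⟨fun V => φ.1 ⟨V.1, V.2.trans h⟩, fun V W h' m => φ.2 ⟨V.1, _⟩ ⟨W.1, _⟩ h' m⟩
  map_zero' := rfl
  map_add' _ _ := rfl

/-- The presheaf `U ↦ Hom(M|_U, N|_U)`. -/
def homPresheaf (M N : X.Modules) : TopCat.Presheaf Ab X where
  obj U := AddCommGrpCat.of (homSections M N U.unop)
  map f := AddCommGrpCat.ofHom (homRes M N f.unop.le)
  map_id _ := rfl
  map_comp _ _ := rfl

instance (M N : X.Modules) (U : (Opens X)ᵒᵖ) :
    Module (X.ringCatSheaf.obj.obj U) ((homPresheaf M N).obj U) :=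
  inferInstanceAs (Module Γ(X, U.unop) (homSections M N U.unop))

lemma homPresheaf_map_smul (M N : X.Modules) {U V : (Opens X)ᵒᵖ} (f : U ⟶ V)
    (a : X.ringCatSheaf.obj.obj U) (φ : (homPresheaf M N).obj U) :
    (homPresheaf M N).map f (a • φ) =
      X.ringCatSheaf.obj.map f a • (homPresheaf M N).map f φ := by
  apply Subtype.ext
  funext V
  apply LinearMap.ext
  intro m
  exact congrArg (fun r : Γ(X, V.1) => r • (φ.1 ⟨V.1, V.2.trans f.unop.le⟩ m : Γ(N, V.1)))
    (functionRes_functionRes f.unop.le V.2 a).symm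

lemma existsUnique_glue (N : X.Modules) {ι : Type} (U : ι → X.Opens) (V : X.Opens)
    (hU : ∀ i, U i ≤ V) (hV : V ≤ iSup U) (t : ∀ i, Γ(N, U i))
    (ht : ∀ i j, sectionRes N (inf_le_left : U i ⊓ U j ≤ U i) (t i) =
      sectionRes N (inf_le_right : U i ⊓ U j ≤ U j) (t j)) :
    ∃! s : Γ(N, V), ∀ i, sectionRes N (hU i) s = t i :=
  TopCat.Sheaf.existsUnique_gluing' ⟨N.presheaf, N.isSheaf⟩ U V (fun i => homOfLE (hU i)) hV t ht

lemma homPresheaf_isSheaf (M N : X.Modules) : (homPresheaf M N).IsSheaf := by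
  refine (TopCat.Presheaf.isSheaf_iff_isSheafUniqueGluing _).2 fun {ι} U sf hsf => ?_
  replace hsf : ∀ i j (V : X.Opens) (h : V ≤ U i ⊓ U j) (m : Γ(M, V)),
      (sf i).1 ⟨V, h.trans inf_le_left⟩ m = (sf j).1 ⟨V, h.trans inf_le_right⟩ m := by
    intro i j V h m
    exact congr($(congrArg Subtype.val (hsf i j)) ⟨V, h⟩ m)
  have key : ∀ (V : {V : X.Opens // V ≤ iSup U}) (m : Γ(M, V.1)), ∃! n : Γ(N, V.1), ∀ i,
      sectionRes N (inf_le_left : V.1 ⊓ U i ≤ V.1) n =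
        (sf i).1 ⟨V.1 ⊓ U i, inf_le_right⟩ (sectionRes M inf_le_left m) := by
    intro V m
    refine existsUnique_glue N (fun i => V.1 ⊓ U i) V.1 (fun i => inf_le_left)
      (by rw [← inf_iSup_eq]; exact le_inf le_rfl V.2) _ fun i j => ?_
    rw [← (sf i).2 ⟨V.1 ⊓ U i, inf_le_right⟩
        ⟨(V.1 ⊓ U i) ⊓ (V.1 ⊓ U j), inf_le_left.trans inf_le_right⟩ inf_le_left,
      ← (sf j).2 ⟨V.1 ⊓ U j, inf_le_right⟩
        ⟨(V.1 ⊓ U i) ⊓ (V.1 ⊓ U j), inf_le_right.trans inf_le_right⟩ inf_le_right,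
      sectionRes_sectionRes, sectionRes_sectionRes]
    exact hsf i j _ (inf_le_inf inf_le_right inf_le_right) _
  choose g hg hg' using key
  refine ⟨⟨fun V => { toFun := g V, map_add' := ?_, map_smul' := ?_ }, ?_⟩, ?_, ?_⟩
  · intro m m'
    refine (hg' V _ _ fun i => ?_).symm
    rw [map_add, map_add, map_add]
    exact congrArg₂ (· + ·) (hg V m i) (hg V m' i)
  · intro a m
    refine (hg' V _ _ fun i => ?_).symm
    rw [RingHom.id_apply, sectionRes_smul, sectionRes_smul, map_smul]
    exact congrArg _ (hg V m i)
  · intro V W h m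
    refine (hg' W _ _ fun i => ?_).symm
    rw [sectionRes_sectionRes, sectionRes_sectionRes, ← sectionRes_sectionRes N (inf_le_left : V.1 ⊓ U i ≤ V.1)
      (inf_le_inf_right _ h : W.1 ⊓ U i ≤ V.1 ⊓ U i)]
    refine (congrArg _ (hg V m i)).trans ?_
    rw [← (sf i).2 ⟨V.1 ⊓ U i, inf_le_right⟩ ⟨W.1 ⊓ U i, inf_le_right⟩, sectionRes_sectionRes]
  · intro i
    apply Subtype.ext
    funext V
    apply LinearMap.ext
    intro m
    refine (hg' ⟨V.1, V.2.trans (le_iSup U i)⟩ m _ fun j => ?_).symm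
    rw [← (sf i).2 V ⟨V.1 ⊓ U j, inf_le_left.trans V.2⟩]
    exact hsf i j _ (le_inf (inf_le_left.trans V.2) inf_le_right) _
  · intro φ hφ
    apply Subtype.ext
    funext V
    apply LinearMap.ext
    intro m
    refine hg' V m _ fun i => ?_
    rw [← φ.2 V ⟨V.1 ⊓ U i, inf_le_left.trans V.2⟩ inf_le_left]
    exact congr($(congrArg Subtype.val (hφ i)) ⟨V.1 ⊓ U i, inf_le_right⟩ (sectionRes M inf_le_left m))

/-- The sheaf of homomorphisms `ℋom(M, N)`. -/
def homSheaf (M N : X.Modules) : X.Modules where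
  val := PresheafOfModules.ofPresheaf (homPresheaf M N)
    (fun _ _ f a φ => homPresheaf_map_smul M N f a φ)
  isSheaf := homPresheaf_isSheaf M N

/-- The dual `M^∨ = ℋom(M, 𝒪_X)`. -/
def dualSheaf (M : X.Modules) : X.Modules := homSheaf M (structureSheaf X)

/-- The presheaf of modules under `M`, seen over the presheaf of commutative rings `𝒪_X`. -/
abbrev commRingVal (M : X.Modules) :
    _root_.PresheafOfModules.{0} (X.presheaf ⋙ forget₂ CommRingCat RingCat) := M.val

/-- The tensor product `M ⊗ N` of `𝒪_X`-modules: the sheaf associated with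
`U ↦ M(U) ⊗ N(U)`. -/
def tensorSheaf (M N : X.Modules) : X.Modules :=
  (PresheafOfModules.sheafification (𝟙 X.ringCatSheaf.obj)).obj
    (PresheafOfModules.Monoidal.tensorObj (commRingVal M) (commRingVal N))


/-- The section `m ⊗ n` of `M ⊗ N` defined by sections `m` of `M` and `n` of `N`. -/
def tensorSections (M N : X.Modules) (U : X.Opens) (m : Γ(M, U)) (n : Γ(N, U)) :
    Γ(tensorSheaf M N, U) :=
  ((PresheafOfModules.sheafificationAdjunction (𝟙 X.ringCatSheaf.obj)).unit.app
    (PresheafOfModules.Monoidal.tensorObj (commRingVal M) (commRingVal N))).app (op U)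
    ((m : (commRingVal M).obj (op U)) ⊗ₜ[Γ(X, U)] (n : (commRingVal N).obj (op U)))


lemma tensorSections_add_left (M N : X.Modules) (U : X.Opens) (m m' : Γ(M, U)) (n : Γ(N, U)) :
    tensorSections M N U (m + m') n = tensorSections M N U m n + tensorSections M N U m' n := by
  unfold tensorSections
  exact (congrArg _ (TensorProduct.add_tmul _ _ _)).trans (map_add _ _ _)

lemma tensorSections_add_right (M N : X.Modules) (U : X.Opens) (m : Γ(M, U)) (n n' : Γ(N, U)) :
    tensorSections M N U m (n + n') = tensorSections M N U m n + tensorSections M N U m n' := by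
  unfold tensorSections
  exact (congrArg _ (TensorProduct.tmul_add _ _ _)).trans (map_add _ _ _)

lemma tensorSections_smul_left (M N : X.Modules) (U : X.Opens) (a : Γ(X, U)) (m : Γ(M, U))
    (n : Γ(N, U)) : tensorSections M N U (a • m) n = a • tensorSections M N U m n := by
  unfold tensorSections
  refine (congrArg _ (TensorProduct.smul_tmul' _ _ _).symm).trans ?_
  exact (((PresheafOfModules.sheafificationAdjunction (𝟙 X.ringCatSheaf.obj)).unit.app
    (PresheafOfModules.Monoidal.tensorObj (commRingVal M) (commRingVal N))).app
      (op U)).hom.map_smul a _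

lemma tensorSections_smul_right (M N : X.Modules) (U : X.Opens) (a : Γ(X, U)) (m : Γ(M, U))
    (n : Γ(N, U)) : tensorSections M N U m (a • n) = a • tensorSections M N U m n := by
  unfold tensorSections
  refine (congrArg _ ((TensorProduct.mk Γ(X, U) ((commRingVal M).obj (op U))
    ((commRingVal N).obj (op U)) m).map_smul a n)).trans ?_
  exact (((PresheafOfModules.sheafificationAdjunction (𝟙 X.ringCatSheaf.obj)).unit.app
    (PresheafOfModules.Monoidal.tensorObj (commRingVal M) (commRingVal N))).app
      (op U)).hom.map_smul a _

/-- A section of the module `𝒪_X` is a regular function. -/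
def asFunction {U : X.Opens} (a : Γ(structureSheaf X, U)) : Γ(X, U) := a

/-- The homomorphism `m ↦ φ(m) • l` from `M|_U` to `L|_U`, for `l ∈ L(U)` and a section `φ` of the
dual of `M` over `U`. -/
def pairingHom (L M : X.Modules) (U : X.Opens) (l : Γ(L, U)) (φ : homSections M (structureSheaf X) U) :
    homSections M L U :=
  ⟨fun V =>
    { toFun := fun m => asFunction (φ.1 V m) • sectionRes L V.2 l
      map_add' := fun m m' => by
        rw [map_add]; exact add_smul (asFunction (φ.1 V m)) (asFunction (φ.1 V m')) _
      map_smul' := fun a m => by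
        rw [map_smul]; exact mul_smul a (asFunction (φ.1 V m)) _ },
    fun V W h m => by
      refine .trans ?_ (sectionRes_smul _ _ _ _).symm
      rw [sectionRes_sectionRes]
      exact congrArg (fun r => asFunction r • sectionRes L W.2 l) (φ.2 V W h m)⟩

/-- `pairingHom` as a bilinear map. -/
def pairingBilin (L M : X.Modules) (U : X.Opens) :
    Γ(L, U) →ₗ[Γ(X, U)] homSections M (structureSheaf X) U →ₗ[Γ(X, U)] homSections M L U :=
  LinearMap.mk₂ Γ(X, U) (pairingHom L M U)
    (fun l l' φ => by
      ext V m; exact (congrArg (asFunction (φ.1 V m) • ·) (map_add _ l l')).trans (smul_add _ _ _))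
    (fun a l φ => by
      ext V m
      refine (congrArg (asFunction (φ.1 V m) • ·) (sectionRes_smul _ _ a l)).trans (smul_comm _ _ _))
    (fun l φ ψ => by
      ext V m; exact add_smul (asFunction (φ.1 V m)) (asFunction (ψ.1 V m)) _)
    (fun a l φ => by
      ext V m; exact mul_smul (functionRes V.2 a) (asFunction (φ.1 V m)) (sectionRes L V.2 l))

/-- The contraction `l ⊗ φ ↦ (m ↦ φ(m) • l)` on the presheaf tensor product. -/
def contractionPresheaf (L M : X.Modules) :
    PresheafOfModules.Monoidal.tensorObj (commRingVal L) (commRingVal (dualSheaf M)) ⟶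
      commRingVal (homSheaf M L) where
  app U := ModuleCat.MonoidalCategory.tensorLift (R := X.presheaf.obj U)
    (M₃ := (commRingVal (homSheaf M L)).obj U)
    (fun l φ => pairingBilin L M U.unop l φ)
    (fun l l' φ => by exact (pairingBilin L M U.unop).map_add₂ l l' φ)
    (fun a l φ => by exact (pairingBilin L M U.unop).map_smul₂ a l φ)
    (fun l φ ψ => by exact (pairingBilin L M U.unop l).map_add φ ψ)
    (fun a l φ => by exact (pairingBilin L M U.unop l).map_smul a φ)
  naturality {U V} f := ModuleCat.MonoidalCategory.tensor_ext (fun l φ => by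
    apply Subtype.ext
    funext W
    apply LinearMap.ext
    intro m
    exact congrArg ((asFunction (φ.1 ⟨W.1, W.2.trans f.unop.le⟩ m)) • ·) (sectionRes_sectionRes L f.unop.le W.2 l))

/-- The canonical morphism `L ⊗ M^∨ → ℋom(M, L)`, `l ⊗ φ ↦ (m ↦ φ(m) • l)`. -/
def contraction (L M : X.Modules) : tensorSheaf L (dualSheaf M) ⟶ homSheaf M L :=
  (PresheafOfModules.sheafificationHomEquiv (𝟙 X.ringCatSheaf.obj)).symm (contractionPresheaf L M)


lemma contraction_tensorSections (L M : X.Modules) (U : X.Opens) (l : Γ(L, U))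
    (φ : homSections M (structureSheaf X) U) :
    (contraction L M).app U (tensorSections L (dualSheaf M) U l φ) = pairingHom L M U l φ := by
  have h : (PresheafOfModules.sheafificationHomEquiv (𝟙 X.ringCatSheaf.obj)) (contraction L M) =
    contractionPresheaf L M := Equiv.apply_symm_apply _ _
  exact congr($(congrArg (fun f => PresheafOfModules.Hom.app f (op U)) h)
    ((l : (commRingVal L).obj (op U)) ⊗ₜ[Γ(X, U)] (φ : (commRingVal (dualSheaf M)).obj (op U))))

/-- A line bundle: an `𝒪_X`-module that is locally isomorphic to `𝒪_X`. -/
def IsLineBundle (M : X.Modules) : Prop :=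
  ∀ x : X, ∃ U : X.Opens, x ∈ U ∧ Nonempty (M.restrict U.ι ≅ structureSheaf U.toScheme)

/-- The stalk `M_x` is a module over the local ring `𝒪_{X,x}`. -/
instance stalkModule (M : X.Modules) (x : X) :
    Module (X.presheaf.stalk x) ↑(TopCat.Presheaf.stalk (C := Ab) M.presheaf x) :=
  inferInstanceAs (Module (X.presheaf.stalk x)
    ↑(TopCat.Presheaf.stalk (C := Ab) (commRingVal M).presheaf x))

/-- No point is a base point: at every point `x` some global section of `M` does not vanish, that is,
its germ does not lie in `𝔪_x M_x`. -/
def IsBasePointFree (M : X.Modules) : Prop :=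
  ∀ x : X, ∃ s : Γ(M, ⊤), M.presheaf.germ ⊤ x trivial s ∉
    (IsLocalRing.maximalIdeal (X.presheaf.stalk x) •
      (⊤ : Submodule (X.presheaf.stalk x) ↑(TopCat.Presheaf.stalk (C := Ab) M.presheaf x)))

/-- The base `Spec ℂ`. -/
abbrev SpecC : Scheme.{0} := Spec (CommRingCat.of ℂ)

attribute [local instance] MvPolynomial.gradedAlgebra

/-- Projective space of dimension `n` over `ℂ`, as `Proj ℂ[x_0, …, x_n]`. -/
def projectiveSpace (n : ℕ) : Scheme.{0} :=
  Proj (MvPolynomial.homogeneousSubmodule (Fin (n + 1)) ℂ)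

/-- The structure morphism of projective space. -/
def projectiveSpaceToSpec (n : ℕ) : projectiveSpace n ⟶ SpecC :=
  Proj.toSpecZero (MvPolynomial.homogeneousSubmodule (Fin (n + 1)) ℂ) ≫
    Spec.map (CommRingCat.ofHom
      (algebraMap ℂ (MvPolynomial.homogeneousSubmodule (Fin (n + 1)) ℂ 0)))

/-- `X` is projective over `ℂ`: it is a closed subscheme of some projective space over `ℂ`. -/
def IsProjectiveOverC (X : Scheme.{0}) [X.Over SpecC] : Prop :=
  ∃ (n : ℕ) (i : X ⟶ projectiveSpace n), IsClosedImmersion i ∧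
    i ≫ projectiveSpaceToSpec n = X ↘ SpecC

/-- The space `H⁰(X, M)` of global sections. -/
def H0 (M : X.Modules) : Type := Γ(M, ⊤)

instance (M : X.Modules) : AddCommGroup (H0 M) := inferInstanceAs (AddCommGroup Γ(M, ⊤))

instance (M : X.Modules) : Module Γ(X, ⊤) (H0 M) := inferInstanceAs (Module Γ(X, ⊤) Γ(M, ⊤))

/-- The ring homomorphism `ℂ → 𝒪_X(X)` given by the structure morphism `X → Spec ℂ`. -/
def scalars (X : Scheme.{0}) [X.Over SpecC] : ℂ →+* Γ(X, ⊤) :=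
  ((Scheme.ΓSpecIso (CommRingCat.of ℂ)).inv ≫ (X ↘ SpecC).appTop).hom

variable [X.Over SpecC]

instance (M : X.Modules) : Module ℂ (H0 M) := Module.compHom (H0 M) (scalars X)

lemma complex_smul_def (M : X.Modules) (c : ℂ) (m : H0 M) : c • m = scalars X c • m := rfl

/-- The product `H⁰(M) × H⁰(N) → H⁰(M ⊗ N)`, `(m, n) ↦ m ⊗ n`. -/
def sectionMul (M N : X.Modules) : H0 M →ₗ[ℂ] H0 N →ₗ[ℂ] H0 (tensorSheaf M N) :=
  LinearMap.mk₂ ℂ (tensorSections M N ⊤)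
    (tensorSections_add_left M N ⊤)
    (fun c m n => tensorSections_smul_left M N ⊤ (scalars X c) m n)
    (tensorSections_add_right M N ⊤)
    (fun c m n => tensorSections_smul_right M N ⊤ (scalars X c) m n)

/-- The product `H⁰(M) × H⁰(𝒪_X) → H⁰(M)`, `(m, a) ↦ a • m`. -/
def sectionSMul (M : X.Modules) : H0 M →ₗ[ℂ] H0 (structureSheaf X) →ₗ[ℂ] H0 M :=
  LinearMap.mk₂ ℂ (fun m a => (asFunction a • m : H0 M))
    (fun m m' a => smul_add (asFunction a) m m')
    (fun c m a => smul_comm (asFunction a) (scalars X c) m)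
    (fun m a b => add_smul (asFunction a) (asFunction b) m)
    (fun c m a => mul_smul (scalars X c) (asFunction a) m)

/-- Evaluation `(φ, m) ↦ φ(m)` of a homomorphism `φ : M → L` at a global section `m` of `M`. -/
def evalSection (M L : X.Modules) : H0 (homSheaf M L) →ₗ[ℂ] H0 M →ₗ[ℂ] H0 L :=
  LinearMap.mk₂ ℂ (fun (φ : homSections M L ⊤) (m : H0 M) => (φ.1 ⟨⊤, le_rfl⟩ m : H0 L))
    (fun _ _ _ => rfl)
    (fun c φ m => congrArg (fun a : Γ(X, ⊤) => a • (φ.1 ⟨⊤, le_rfl⟩ m : H0 L))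
      congr($(X.presheaf.map_id (op ⊤)).hom (scalars X c)))
    (fun φ m m' => (φ.1 ⟨⊤, le_rfl⟩).map_add m m')
    (fun c φ m => (φ.1 ⟨⊤, le_rfl⟩).map_smul (scalars X c) m)

/-- The contraction `L ⊗ M^∨ → ℋom(M, L)` on global sections. -/
def contractionH0 (L M : X.Modules) : H0 (tensorSheaf L (dualSheaf M)) →ₗ[ℂ] H0 (homSheaf M L) where
  toFun n := (contraction L M).app ⊤ n
  map_add' n n' := map_add ((contraction L M).app ⊤).hom n n'
  map_smul' c n := (contraction L M).app_smul (scalars X c) n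

/-- The multiplication of sections `H⁰(L ⊗ M^∨) × H⁰(M) → H⁰(L)`. -/
def contractionMul (L M : X.Modules) : H0 (tensorSheaf L (dualSheaf M)) →ₗ[ℂ] H0 M →ₗ[ℂ] H0 L :=
  evalSection M L ∘ₗ contractionH0 L M

section Koszul

variable {k V A B : Type} [CommRing k] [AddCommGroup V] [Module k V] [AddCommGroup A] [Module k A]
  [AddCommGroup B] [Module k B]

instance wedgeTensorAddCommGroup (p : ℕ) : AddCommGroup ((⋀[k]^p V) ⊗[k] A) :=
  Module.addCommMonoidToAddCommGroup k

/-- For `v ∈ V`, the alternating map `x ↦ (a ↦ (x_1 ∧ ⋯ ∧ x_p) ⊗ μ(v, a))`. -/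
def koszulContraction (p : ℕ) (μ : V →ₗ[k] A →ₗ[k] B) :
    V →ₗ[k] V [⋀^Fin p]→ₗ[k] (A →ₗ[k] (⋀[k]^p V) ⊗[k] B) where
  toFun v := ((LinearMap.lcomp k ((⋀[k]^p V) ⊗[k] B) (μ v)) ∘ₗ
    TensorProduct.mk k (⋀[k]^p V) B).compAlternatingMap (exteriorPower.ιMulti k p)
  map_add' v w := by
    ext x a
    simp [TensorProduct.tmul_add]
  map_smul' c v := by
    ext x a
    simp

/-- The Koszul differential `⋀^{p+1} V ⊗ A → ⋀^p V ⊗ B` of a bilinear map `μ : V × A → B`,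
`(v_0 ∧ ⋯ ∧ v_p) ⊗ a ↦ ∑ i, (-1)^i (v_0 ∧ ⋯ ∧ v̂_i ∧ ⋯ ∧ v_p) ⊗ μ(v_i, a)`. -/
def koszulDifferential (p : ℕ) (μ : V →ₗ[k] A →ₗ[k] B) :
    (⋀[k]^(p + 1) V) ⊗[k] A →ₗ[k] (⋀[k]^p V) ⊗[k] B :=
  TensorProduct.lift (exteriorPower.alternatingMapLinearEquiv
    (R := k) (M := V) (N := A →ₗ[k] (⋀[k]^p V) ⊗[k] B)
    (AlternatingMap.alternatizeUncurryFin (koszulContraction p μ)))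

lemma koszulDifferential_tmul (p : ℕ) (μ : V →ₗ[k] A →ₗ[k] B) (v : Fin (p + 1) → V) (a : A) :
    koszulDifferential p μ (exteriorPower.ιMulti k (p + 1) v ⊗ₜ a) =
      ∑ i : Fin (p + 1), (-1) ^ (i : ℕ) •
        (exteriorPower.ιMulti k p (fun j => v (i.succAbove j)) ⊗ₜ μ (v i) a) := by
  simp [koszulDifferential, AlternatingMap.alternatizeUncurryFin_apply, LinearMap.sum_apply]
  rfl

/-- The kernel of the Koszul differential `⋀^p V ⊗ A → ⋀^{p-1} V ⊗ B`, where `⋀^{-1} V = 0`. -/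
def koszulCycles : (p : ℕ) → (V →ₗ[k] A →ₗ[k] B) → Submodule k ((⋀[k]^p V) ⊗[k] A)
  | 0, _ => ⊤
  | p + 1, μ => LinearMap.ker (koszulDifferential p μ)

variable {C : Type} [AddCommGroup C] [Module k C]

/-- The middle cohomology of `⋀^{p+1} V ⊗ A → ⋀^p V ⊗ B → ⋀^{p-1} V ⊗ C`. -/
abbrev KoszulCohomology (p : ℕ) (μ : V →ₗ[k] A →ₗ[k] B) (ν : V →ₗ[k] B →ₗ[k] C) : Type :=
  koszulCycles p ν ⧸ (LinearMap.range (koszulDifferential p μ)).submoduleOf (koszulCycles p ν)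

end Koszul

/-- The Koszul cohomology group `K_{p,1}(X, L; W)` for a subspace `W ⊆ H⁰(L)`: the middle cohomology
of `⋀^{p+1} W ⊗ H⁰(𝒪_X) → ⋀^p W ⊗ H⁰(L) → ⋀^{p-1} W ⊗ H⁰(L ⊗ L)`. -/
abbrev SyzygySpace (L : X.Modules) (W : Submodule ℂ (H0 L)) (p : ℕ) : Type :=
  KoszulCohomology p (sectionSMul L ∘ₗ W.subtype) (sectionMul L L ∘ₗ W.subtype)

/-- Multiplication by `s ∈ H⁰(M)`, from `H⁰(L ⊗ M^∨)` to `H⁰(L)`. -/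
def mulBySection (L M : X.Modules) (s : H0 M) : H0 (tensorSheaf L (dualSheaf M)) →ₗ[ℂ] H0 L :=
  (contractionMul L M).flip s

/-- The map `⋀^{p+1} H⁰(L ⊗ M^∨) ⊗ H⁰(M) → ⋀^p W ⊗ H⁰(L)`,
`(n_0 ∧ ⋯ ∧ n_p) ⊗ m ↦ ∑ i, (-1)^i (s n_0 ∧ ⋯ (omit i) ⋯ ∧ s n_p) ⊗ n_i m`,
where `W = s • H⁰(L ⊗ M^∨) ⊆ H⁰(L)`. -/
def syzygyMap (L M : X.Modules) (s : H0 M) (p : ℕ) :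
    (⋀[ℂ]^(p + 1) (H0 (tensorSheaf L (dualSheaf M)))) ⊗[ℂ] H0 M →ₗ[ℂ]
      (⋀[ℂ]^p (LinearMap.range (mulBySection L M s))) ⊗[ℂ] H0 L :=
  (exteriorPower.map p (mulBySection L M s).rangeRestrict).rTensor (H0 L) ∘ₗ
    koszulDifferential p (contractionMul L M)

end SyzygyBundles

end

open SyzygyBundles

/-! Write `V` for `H⁰(L ⊗ M^∨)`, of dimension `p + 1`, and let `ω` generate `⋀^{p+1} V`. The wedge
pairing of `⋀^p V` with `V` is perfect, so an element `z` of `⋀^p V ⊗ B` amounts to a linear map `l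
: V → B`, determined by `v ∧ z = ω ⊗ l(v)`. The Leibniz rule `d(v ∧ z) = v·z - v ∧ dz` translates
the Koszul complex into these terms. If `z` is a cycle, then `v · l(w) = w · l(v)` for all `v`, `w`;
and `d(ω ⊗ a)` corresponds to `v ↦ v·a`. This algebra is condensed in
`exists_equiv_koszulCohomology`.

The geometry lies in the symmetric maps `l : V → H⁰(L)`. The relation `(s n) · l(n') = (s n') ·
l(n)` says that `l(n)/n` is a rational section of `M` independent of `n`. It is regular because near
every point some `n` does not vanish, so `l` is multiplication by a section of `M`: this is
`exists_sectionHom_eq`. That section is unique by `eq_of_forall_sectionHom_eq`, and every section of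
`M` gives a cycle by `tensorSections_sectionHom_comm`. The boundaries come from multiplying by `s`
times a global function. By `scalars_surjective` such functions are constants, so what is divided
out is the line spanned by `s`. -/

noncomputable section
namespace SyzygyBundles

/-! ### Koszul differentials and the Leibniz rule -/

section KoszulAlgebra

variable {k V A B C : Type} [Field k] [AddCommGroup V] [Module k V] [AddCommGroup A] [Module k A]
  [AddCommGroup B] [Module k B] [AddCommGroup C] [Module k C]

/-- Left multiplication `v ↦ (x ↦ v ∧ x)` on exterior powers. -/
def wedgeLeft (n : ℕ) : V →ₗ[k] (⋀[k]^n V) →ₗ[k] ⋀[k]^(n + 1) V :=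
  (exteriorPower.alternatingMapLinearEquiv (R := k) (M := V) (N := ⋀[k]^(n + 1) V)).toLinearMap ∘ₗ
    (exteriorPower.ιMulti k (n + 1)).curryLeft

lemma wedgeLeft_ιMulti (n : ℕ) (v : V) (x : Fin n → V) :
    wedgeLeft n v (exteriorPower.ιMulti k n x) = exteriorPower.ιMulti k (n + 1) (Fin.cons v x) := by
  simp [wedgeLeft]
  rfl

lemma wedgeTensor_ext {n : ℕ} {f g : (⋀[k]^n V) ⊗[k] A →ₗ[k] B}
    (h : ∀ x a, f (exteriorPower.ιMulti k n x ⊗ₜ a) = g (exteriorPower.ιMulti k n x ⊗ₜ a)) :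
    f = g := by
  apply TensorProduct.ext
  apply exteriorPower.linearMap_ext
  ext x a
  exact h x a

lemma koszulDifferential_zero_wedgeLeft (μ : V →ₗ[k] A →ₗ[k] B) (v : V) (z : (⋀[k]^0 V) ⊗[k] A) :
    koszulDifferential 0 μ ((wedgeLeft 0 v).rTensor A z) = (μ v).lTensor _ z := by
  refine LinearMap.congr_fun (f := koszulDifferential 0 μ ∘ₗ (wedgeLeft 0 v).rTensor A)
    (wedgeTensor_ext fun x a => ?_) z
  simp only [LinearMap.comp_apply, LinearMap.rTensor_tmul, LinearMap.lTensor_tmul, wedgeLeft_ιMulti,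
    koszulDifferential_tmul]
  simp

/-- Leibniz rule. The summand that omits the leading factor `v` gives `v·z`; the others keep `v` in
front, and the shift of their index by one produces the minus sign. -/
lemma koszulDifferential_succ_wedgeLeft (n : ℕ) (μ : V →ₗ[k] A →ₗ[k] B) (v : V)
    (z : (⋀[k]^(n + 1) V) ⊗[k] A) :
    koszulDifferential (n + 1) μ ((wedgeLeft (n + 1) v).rTensor A z) =
      (μ v).lTensor _ z - (wedgeLeft n v).rTensor B (koszulDifferential n μ z) := by
  refine LinearMap.congr_fun (f := koszulDifferential (n + 1) μ ∘ₗ (wedgeLeft (n + 1) v).rTensor A)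
    (g := (μ v).lTensor _ - (wedgeLeft n v).rTensor B ∘ₗ koszulDifferential n μ)
    (wedgeTensor_ext fun x a => ?_) z
  simp only [LinearMap.comp_apply, LinearMap.rTensor_tmul, LinearMap.lTensor_tmul, wedgeLeft_ιMulti,
    koszulDifferential_tmul, LinearMap.sub_apply, map_sum, map_zsmul]
  rw [Fin.sum_univ_succ, sub_eq_add_neg, ← Finset.sum_neg_distrib]
  congr 1
  · simp
  · refine Finset.sum_congr rfl fun i _ => ?_
    have : (fun j => (Fin.cons v x : Fin (n + 2) → V) (i.succ.succAbove j)) =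
        Fin.cons v (fun j => x (i.succAbove j)) := by
      funext j
      refine Fin.cases ?_ (fun j => ?_) j
      · simp
      · simp
    rw [this]
    simp [pow_succ]

lemma koszulDifferential_lTensor {D : Type} [AddCommGroup D] [Module k D] (n : ℕ)
    (μ : V →ₗ[k] A →ₗ[k] B) (ν : V →ₗ[k] C →ₗ[k] D) (f : A →ₗ[k] C) (g : B →ₗ[k] D)
    (h : ∀ v a, ν v (f a) = g (μ v a)) (z : (⋀[k]^(n + 1) V) ⊗[k] A) :
    koszulDifferential n ν (f.lTensor _ z) = g.lTensor _ (koszulDifferential n μ z) := by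
  refine LinearMap.congr_fun (f := koszulDifferential n ν ∘ₗ f.lTensor _)
    (g := g.lTensor _ ∘ₗ koszulDifferential n μ) (wedgeTensor_ext fun x a => ?_) z
  simp [koszulDifferential_tmul, h]

lemma koszulDifferential_map {W : Type} [AddCommGroup W] [Module k W] (n : ℕ)
    (μ : V →ₗ[k] A →ₗ[k] B) (ν : W →ₗ[k] A →ₗ[k] B) (f : V →ₗ[k] W)
    (h : ∀ v a, ν (f v) a = μ v a) (z : (⋀[k]^(n + 1) V) ⊗[k] A) :
    koszulDifferential n ν ((exteriorPower.map (n + 1) f).rTensor A z) =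
      (exteriorPower.map n f).rTensor B (koszulDifferential n μ z) := by
  refine LinearMap.congr_fun (f := koszulDifferential n ν ∘ₗ (exteriorPower.map (n + 1) f).rTensor A)
    (g := (exteriorPower.map n f).rTensor B ∘ₗ koszulDifferential n μ)
    (wedgeTensor_ext fun x a => ?_) z
  simp [koszulDifferential_tmul, h, Function.comp_def, map_zsmul]

lemma wedgeTensor_ext_wedgeLeft {n : ℕ} {f g : (⋀[k]^(n + 1) V) ⊗[k] A →ₗ[k] B}
    (h : ∀ v z, f ((wedgeLeft n v).rTensor A z) = g ((wedgeLeft n v).rTensor A z)) :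
    f = g := by
  refine wedgeTensor_ext fun x a => ?_
  have := h (x 0) (exteriorPower.ιMulti k n (Fin.tail x) ⊗ₜ a)
  simpa [wedgeLeft_ιMulti] using this

/-- By two uses of the Leibniz rule, `dd(v ∧ z) = d(v·z) - v·dz + v ∧ ddz`. The first two terms
cancel since the products commute, and the last vanishes by induction; in the lowest degree it is
absent. -/
lemma koszulDifferential_koszulDifferential (n : ℕ) (μ : V →ₗ[k] A →ₗ[k] B)
    (ν : V →ₗ[k] B →ₗ[k] C) (h : ∀ v w a, ν v (μ w a) = ν w (μ v a))
    (z : (⋀[k]^(n + 2) V) ⊗[k] A) :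
    koszulDifferential n ν (koszulDifferential (n + 1) μ z) = 0 := by
  induction n with
  | zero =>
    refine LinearMap.congr_fun (f := koszulDifferential 0 ν ∘ₗ koszulDifferential 1 μ) (g := 0)
      (wedgeTensor_ext_wedgeLeft fun v z => ?_) z
    simp only [LinearMap.comp_apply, LinearMap.zero_apply, koszulDifferential_succ_wedgeLeft,
      map_sub, koszulDifferential_zero_wedgeLeft]
    rw [koszulDifferential_lTensor 0 μ ν (μ v) (ν v) (fun w a => h w v a), sub_self]
  | succ n ih =>
    refine LinearMap.congr_fun (f := koszulDifferential (n + 1) ν ∘ₗ koszulDifferential (n + 2) μ)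
      (g := 0) (wedgeTensor_ext_wedgeLeft fun v z => ?_) z
    simp only [LinearMap.comp_apply, LinearMap.zero_apply, koszulDifferential_succ_wedgeLeft,
      map_sub, ih, map_zero, sub_zero]
    rw [koszulDifferential_lTensor (n + 1) μ ν (μ v) (ν v) (fun w a => h w v a), sub_self]

lemma koszulDifferential_mem_cycles (p : ℕ) (μ : V →ₗ[k] A →ₗ[k] B)
    (ν : V →ₗ[k] B →ₗ[k] C) (h : ∀ v w a, ν v (μ w a) = ν w (μ v a))
    (z : (⋀[k]^(p + 1) V) ⊗[k] A) : koszulDifferential p μ z ∈ koszulCycles p ν := by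
  cases p with
  | zero => trivial
  | succ n => exact koszulDifferential_koszulDifferential n μ ν h z

lemma koszulDifferential_wedgeLeft_of_mem_cycles (p : ℕ) (ν : V →ₗ[k] B →ₗ[k] C) (v : V)
    (z : (⋀[k]^p V) ⊗[k] B) (hz : z ∈ koszulCycles p ν) :
    koszulDifferential p ν ((wedgeLeft p v).rTensor B z) = (ν v).lTensor _ z := by
  cases p with
  | zero => exact koszulDifferential_zero_wedgeLeft ν v z
  | succ n =>
    rw [koszulDifferential_succ_wedgeLeft, LinearMap.mem_ker.1 hz, map_zero, sub_zero]

/-! ### Duality between `⋀^p V` and `V` when `dim V = p + 1` -/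

section TopPower

variable {p : ℕ} (b : Module.Basis (Fin (p + 1)) k V)

include b in
lemma finrank_topPower : Module.finrank k (⋀[k]^(p + 1) V) = 1 := by
  have := Module.Finite.of_basis b
  rw [exteriorPower.finrank_eq, Module.finrank_eq_card_basis b]
  simp

lemma ιMulti_basis_ne_zero : exteriorPower.ιMulti k (p + 1) b ≠ 0 := by
  intro h
  have := (exteriorPower.alternatingMapLinearEquiv_apply_ιMulti (R := k) b.det b)
  rw [h, map_zero, b.det_self] at this
  exact zero_ne_one this

/-- The isomorphism `a ↦ (b_0 ∧ ⋯ ∧ b_p) ⊗ a`. -/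
def topPowerTensorEquiv (A : Type) [AddCommGroup A] [Module k A] :
    A ≃ₗ[k] (⋀[k]^(p + 1) V) ⊗[k] A :=
  LinearEquiv.ofBijective (TensorProduct.mk k (⋀[k]^(p + 1) V) A (exteriorPower.ιMulti k (p + 1) b)) <| by
    have h : Function.Bijective
        (LinearMap.toSpanSingleton k (⋀[k]^(p + 1) V) (exteriorPower.ιMulti k (p + 1) b)) :=
      ⟨smul_left_injective k (ιMulti_basis_ne_zero b), fun x =>
        exists_smul_eq_of_finrank_eq_one (finrank_topPower b) (ιMulti_basis_ne_zero b) x⟩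
    have : TensorProduct.mk k (⋀[k]^(p + 1) V) A (exteriorPower.ιMulti k (p + 1) b) =
        ((TensorProduct.lid k A).symm ≪≫ₗ (LinearEquiv.ofBijective _ h).rTensor A).toLinearMap := by
      ext a
      simp
    rw [this]
    exact LinearEquiv.bijective _

lemma topPowerTensorEquiv_apply (a : A) :
    topPowerTensorEquiv b A a = exteriorPower.ιMulti k (p + 1) b ⊗ₜ a := rfl

lemma exists_ιMulti_family_eq_succAbove (s : Set.powersetCard (Fin (p + 1)) p) :
    ∃ i : Fin (p + 1), exteriorPower.ιMulti_family k p b s =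
      exteriorPower.ιMulti k p (fun j => b (i.succAbove j)) := by
  obtain ⟨t, ht⟩ := s
  have ht' : t.card = p := ht
  -- A `p`-element subset of `p + 1` indices omits exactly one index.
  have hc : tᶜ.card = 1 := by rw [Finset.card_compl, ht']; simp
  obtain ⟨i, hi⟩ := Finset.card_eq_one.1 hc
  obtain rfl : t = {i}ᶜ := by rw [← hi, compl_compl]
  refine ⟨i, ?_⟩
  rw [exteriorPower.ιMulti_family, Set.powersetCard.ofFinEmbEquiv_symm_apply]
  congr 1
  funext j
  have := Finset.orderEmbOfFin_compl_singleton (n := p) (i := i) ht'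
  exact congrArg (fun f => b (f j)) this

lemma exists_eq_sum_ιMulti_succAbove (z : (⋀[k]^p V) ⊗[k] A) :
    ∃ l : Fin (p + 1) → A,
      z = ∑ i, exteriorPower.ιMulti k p (fun j => b (i.succAbove j)) ⊗ₜ[k] l i := by
  suffices h : ∀ x : ⋀[k]^p V, ∃ c : Fin (p + 1) → k,
      x = ∑ i, c i • exteriorPower.ιMulti k p (fun j => b (i.succAbove j)) by
    induction z with
    | zero => exact ⟨0, by simp⟩
    | tmul x a =>
      obtain ⟨c, rfl⟩ := h x
      exact ⟨fun i => c i • a, by simp [TensorProduct.sum_tmul, TensorProduct.smul_tmul]⟩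
    | add z w hz hw =>
      obtain ⟨l, rfl⟩ := hz
      obtain ⟨l', rfl⟩ := hw
      exact ⟨l + l', by simp [TensorProduct.tmul_add, Finset.sum_add_distrib]⟩
  intro x
  suffices h : x ∈ Submodule.span k
      (Set.range fun i : Fin (p + 1) => exteriorPower.ιMulti k p (fun j => b (i.succAbove j))) by
    obtain ⟨c, hc⟩ := (Submodule.mem_span_range_iff_exists_fun k).1 h
    exact ⟨c, hc.symm⟩
  have hx : x ∈ Submodule.span k (Set.range (exteriorPower.ιMulti_family k p b)) := by
    rw [exteriorPower.ιMulti_family_span_of_span k b.span_eq]; trivial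
  refine Submodule.span_mono ?_ hx
  rintro _ ⟨s, rfl⟩
  obtain ⟨i, hi⟩ := exists_ιMulti_family_eq_succAbove b s
  exact ⟨i, hi.symm⟩

-- Nondegeneracy of the wedge pairing. Wedging with `b i` kills every term of the expansion of `z`
-- except the one that omits `b i`, which becomes, up to sign, the top basis vector tensored with
-- its coefficient.
include b in
lemma eq_zero_of_wedgeLeft_eq_zero (z : (⋀[k]^p V) ⊗[k] A)
    (h : ∀ v, (wedgeLeft p v).rTensor A z = 0) : z = 0 := by
  obtain ⟨l, rfl⟩ := exists_eq_sum_ιMulti_succAbove b z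
  refine Finset.sum_eq_zero fun i _ => ?_
  have hi := h (b i)
  rw [map_sum, Finset.sum_eq_single i] at hi
  -- Moving `b i` to the front is a cyclic permutation of the basis, so only a sign intervenes.
  · have hp : (Fin.cons (b i) fun j => b (i.succAbove j) : Fin (p + 1) → V) =
        b ∘ i.cycleRange.symm := by
      funext j
      refine Fin.cases ?_ (fun j => ?_) j
      · simp
      · simp
    rw [LinearMap.rTensor_tmul, wedgeLeft_ιMulti, hp, AlternatingMap.map_perm] at hi
    have hi' : topPowerTensorEquiv b A (l i) = 0 := by
      rcases Int.units_eq_one_or (Equiv.Perm.sign i.cycleRange.symm) with h1 | h1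
      · rw [h1, one_smul] at hi
        exact hi
      · rw [h1, Units.neg_smul, one_smul, TensorProduct.neg_tmul] at hi
        exact neg_eq_zero.1 hi
    rw [(LinearEquiv.map_eq_zero_iff _).1 hi', TensorProduct.tmul_zero]
  · intro j _ hj
    obtain ⟨m, hm⟩ := Fin.exists_succAbove_eq hj.symm
    rw [LinearMap.rTensor_tmul, wedgeLeft_ιMulti,
      AlternatingMap.map_eq_zero_of_eq _ _ (i := 0) (j := m.succ) (by simp [hm])
        (Fin.succ_ne_zero m).symm, TensorProduct.zero_tmul]
  · simp

include b in
lemma wedgeLeft_topPower (v : V) (z : (⋀[k]^(p + 1) V) ⊗[k] A) :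
    (wedgeLeft (p + 1) v).rTensor A z = 0 := by
  have := Module.Finite.of_basis b
  have h0 : Module.finrank k (⋀[k]^(p + 1 + 1) V) = 0 := by
    rw [exteriorPower.finrank_eq, Module.finrank_eq_card_basis b]
    simp
  have := Module.finrank_zero_iff.1 h0
  rw [Subsingleton.elim (wedgeLeft (p + 1) v) 0]
  simp

-- The term `v ∧ z` of the Leibniz rule lies in `⋀^{p+2} V ⊗ A = 0`. Hence the boundary of `ω ⊗ a`
-- corresponds to the linear map `μ(·, a)`.
include b in
lemma wedgeLeft_koszulDifferential (μ : V →ₗ[k] A →ₗ[k] B) (v : V)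
    (z : (⋀[k]^(p + 1) V) ⊗[k] A) :
    (wedgeLeft p v).rTensor B (koszulDifferential p μ z) = (μ v).lTensor _ z := by
  have := koszulDifferential_succ_wedgeLeft p μ v z
  rw [wedgeLeft_topPower b, map_zero] at this
  exact (sub_eq_zero.1 this.symm).symm

include b in
lemma koszulDifferential_eq_of_eq {A' : Type} [AddCommGroup A'] [Module k A']
    (μ : V →ₗ[k] A →ₗ[k] B) (μ' : V →ₗ[k] A' →ₗ[k] B)
    (z : (⋀[k]^(p + 1) V) ⊗[k] A) (z' : (⋀[k]^(p + 1) V) ⊗[k] A')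
    (h : ∀ v, (μ v).lTensor _ z = (μ' v).lTensor _ z') :
    koszulDifferential p μ z = koszulDifferential p μ' z' := by
  rw [← sub_eq_zero]
  refine eq_zero_of_wedgeLeft_eq_zero b _ fun v => ?_
  rw [map_sub, wedgeLeft_koszulDifferential b, wedgeLeft_koszulDifferential b, h, sub_self]

-- The map `l` attached to a cycle is symmetric, hence of the form `μ(·, m)` by assumption. Then `ω
-- ⊗ m` has boundary `z`, since both have the same wedge product with every vector.
include b in
lemma exists_koszulDifferential_eq (μ : V →ₗ[k] A →ₗ[k] B) (ν : V →ₗ[k] B →ₗ[k] C)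
    (h : ∀ l : V →ₗ[k] B, (∀ v w, ν v (l w) = ν w (l v)) → ∃ m, ∀ v, l v = μ v m)
    (z : (⋀[k]^p V) ⊗[k] B) (hz : z ∈ koszulCycles p ν) :
    ∃ t, koszulDifferential p μ t = z := by
  let l : V →ₗ[k] B := (topPowerTensorEquiv b B).symm.toLinearMap ∘ₗ
    ((LinearMap.rTensorHom B).flip z) ∘ₗ wedgeLeft p
  have hl : ∀ v, exteriorPower.ιMulti k (p + 1) b ⊗ₜ l v = (wedgeLeft p v).rTensor B z := by
    intro v
    rw [← topPowerTensorEquiv_apply]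
    exact LinearEquiv.apply_symm_apply _ _
  obtain ⟨m, hm⟩ := h l fun v w => by
    apply (topPowerTensorEquiv b C).injective
    -- As `z` is a cycle, `w·z = d(w ∧ z)`, and wedging this boundary with `v` gives `v·(w ∧ z)`.
    -- Only here is the cycle condition needed; `comm` holds for any `z`, because the two operations
    -- act on different tensor factors.
    have key : ∀ v w, topPowerTensorEquiv b C (ν v (l w)) =
        (wedgeLeft p v).rTensor C ((ν w).lTensor _ z) := by
      intro v w
      rw [topPowerTensorEquiv_apply, ← LinearMap.lTensor_tmul, hl,
        ← koszulDifferential_wedgeLeft_of_mem_cycles p ν w z hz, wedgeLeft_koszulDifferential b]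
    have comm : ∀ v w, topPowerTensorEquiv b C (ν w (l v)) =
        (wedgeLeft p v).rTensor C ((ν w).lTensor _ z) := by
      intro v w
      rw [topPowerTensorEquiv_apply, ← LinearMap.lTensor_tmul, hl,
        ← LinearMap.comp_apply, ← LinearMap.comp_apply, LinearMap.lTensor_comp_rTensor,
        LinearMap.rTensor_comp_lTensor]
    rw [key, comm]
  refine ⟨exteriorPower.ιMulti k (p + 1) b ⊗ₜ m, ?_⟩
  rw [← sub_eq_zero]
  refine eq_zero_of_wedgeLeft_eq_zero b _ fun v => ?_
  rw [map_sub, wedgeLeft_koszulDifferential b, LinearMap.lTensor_tmul, ← hm, hl, sub_self]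

end TopPower

/-- If `ν`-symmetric homomorphisms `V → B` are exactly the `μ(·, m)`, and the
`κ(·, a)` are exactly the multiples of `μ(·, s)`, then the Koszul cohomology is
`⋀^{p+1} V ⊗ M / ⟨s⟩`, for `p + 1 = dim V`. -/
theorem exists_equiv_koszulCohomology {M : Type} [AddCommGroup M] [Module k M] (p : ℕ)
    (hV : Module.finrank k V = p + 1) (κ : V →ₗ[k] A →ₗ[k] B) (μ : V →ₗ[k] M →ₗ[k] B)
    (ν : V →ₗ[k] B →ₗ[k] C) (s : M)
    (hμν : ∀ v w m, ν v (μ w m) = ν w (μ v m))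
    (hsurj : ∀ l : V →ₗ[k] B, (∀ v w, ν v (l w) = ν w (l v)) → ∃ m, ∀ v, l v = μ v m)
    (hinj : ∀ m, (∀ v, μ v m = 0) → m = 0)
    (hκ : ∀ a, ∃ c : k, ∀ v, κ v a = c • μ v s) (hone : ∃ a, ∀ v, κ v a = μ v s) :
    ∃ e : ((⋀[k]^(p + 1) V) ⊗[k] (M ⧸ Submodule.span k {s})) ≃ₗ[k] KoszulCohomology p κ ν,
      ∀ t : (⋀[k]^(p + 1) V) ⊗[k] M, ∃ h : koszulDifferential p μ t ∈ koszulCycles p ν,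
        e ((Submodule.span k {s}).mkQ.lTensor _ t) =
          Submodule.Quotient.mk ⟨koszulDifferential p μ t, h⟩ := by
  have : Module.Finite k V := Module.finite_of_finrank_pos (by omega)
  let b : Module.Basis (Fin (p + 1)) k V := Module.finBasisOfFinrankEq k V hV
  let K := (LinearMap.range (koszulDifferential p κ)).submoduleOf (koszulCycles p ν)
  let Φ : (⋀[k]^(p + 1) V) ⊗[k] M →ₗ[k] KoszulCohomology p κ ν :=
    K.mkQ ∘ₗ (koszulDifferential p μ).codRestrict _ (koszulDifferential_mem_cycles p μ ν hμν)
  let Q : (⋀[k]^(p + 1) V) ⊗[k] M →ₗ[k] (⋀[k]^(p + 1) V) ⊗[k] (M ⧸ Submodule.span k {s}) :=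
    (Submodule.span k {s}).mkQ.lTensor _
  have hQ : Function.Surjective Q := LinearMap.lTensor_surjective _ (Submodule.mkQ_surjective _)
  have hΦ : Function.Surjective Φ := by
    intro y
    obtain ⟨⟨z, hz⟩, rfl⟩ := Submodule.mkQ_surjective _ y
    obtain ⟨t, rfl⟩ := exists_koszulDifferential_eq b μ ν hsurj z hz
    exact ⟨t, rfl⟩
  -- Source and target are both quotients of `⋀^{p+1} V ⊗ M`, so the isomorphism exists once the two
  -- kernels agree.
  have hker : LinearMap.ker Φ = LinearMap.ker Q := by
    ext t
    obtain ⟨m, rfl⟩ := (topPowerTensorEquiv b M).surjective t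
    have h1 : topPowerTensorEquiv b M m ∈ LinearMap.ker Q ↔ m ∈ Submodule.span k {s} := by
      rw [LinearMap.mem_ker, topPowerTensorEquiv_apply, LinearMap.lTensor_tmul,
        ← topPowerTensorEquiv_apply, LinearEquiv.map_eq_zero_iff]
      simp
    have h2 : topPowerTensorEquiv b M m ∈ LinearMap.ker Φ ↔
        ∃ t, koszulDifferential p κ t = koszulDifferential p μ (topPowerTensorEquiv b M m) :=
      (Submodule.Quotient.mk_eq_zero K).trans Iff.rfl
    rw [h1, h2, Submodule.mem_span_singleton]
    constructor
    · rintro ⟨t, ht⟩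
      obtain ⟨a, rfl⟩ := (topPowerTensorEquiv b A).surjective t
      obtain ⟨c, hc⟩ := hκ a
      refine ⟨c, ?_⟩
      rw [← sub_eq_zero]
      refine hinj _ fun v => ?_
      have := congrArg ((wedgeLeft p v).rTensor B) ht
      rw [wedgeLeft_koszulDifferential b, wedgeLeft_koszulDifferential b,
        topPowerTensorEquiv_apply, topPowerTensorEquiv_apply, LinearMap.lTensor_tmul,
        LinearMap.lTensor_tmul, ← topPowerTensorEquiv_apply, ← topPowerTensorEquiv_apply] at this
      rw [map_sub, map_smul, ← hc, (topPowerTensorEquiv b B).injective this, sub_self]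
    · rintro ⟨c, rfl⟩
      obtain ⟨a, ha⟩ := hone
      refine ⟨topPowerTensorEquiv b A (c • a), koszulDifferential_eq_of_eq b _ _ _ _ fun v => ?_⟩
      rw [topPowerTensorEquiv_apply, topPowerTensorEquiv_apply, LinearMap.lTensor_tmul,
        LinearMap.lTensor_tmul, map_smul, map_smul, ha]
  refine ⟨(Q.quotKerEquivOfSurjective hQ).symm ≪≫ₗ Submodule.quotEquivOfEq _ _ hker.symm ≪≫ₗ
    Φ.quotKerEquivOfSurjective hΦ, fun t => ⟨koszulDifferential_mem_cycles p μ ν hμν t, ?_⟩⟩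
  have : (Q.quotKerEquivOfSurjective hQ).symm (Q t) = (LinearMap.ker Q).mkQ t := by
    rw [LinearEquiv.symm_apply_eq]; rfl
  rw [LinearEquiv.trans_apply, LinearEquiv.trans_apply, this]
  rfl

end KoszulAlgebra

/-! ### Local generators and sections of tensor products -/

variable {X : Scheme.{0}}

lemma sectionRes_self (M : X.Modules) {V : X.Opens} (h : V ≤ V) (m : Γ(M, V)) :
    sectionRes M h m = m :=
  congr($(M.presheaf.map_id (op V)).hom m)

lemma section_ext (M : X.Modules) {U : X.Opens} (m m' : Γ(M, U))
    (h : ∀ x ∈ U, ∃ (V : X.Opens) (hV : V ≤ U), x ∈ V ∧ sectionRes M hV m = sectionRes M hV m') :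
    m = m' := by
  choose V hV hxV hres using fun x : U => h x.1 x.2
  refine (existsUnique_glue M V U hV (fun x hx => Opens.mem_iSup.2 ⟨⟨x, hx⟩, hxV ⟨x, hx⟩⟩)
    (fun x => sectionRes M (hV x) m') fun i j => ?_).unique hres fun i => rfl
  rw [sectionRes_sectionRes, sectionRes_sectionRes]

lemma tensorSections_res (M N : X.Modules) {U V : X.Opens} (h : V ≤ U) (m : Γ(M, U)) (n : Γ(N, U)) :
    sectionRes (tensorSheaf M N) h (tensorSections M N U m n) =
      tensorSections M N V (sectionRes M h m) (sectionRes N h n) := by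
  have := PresheafOfModules.naturality_apply
    ((PresheafOfModules.sheafificationAdjunction (𝟙 X.ringCatSheaf.obj)).unit.app
    (PresheafOfModules.Monoidal.tensorObj (commRingVal M) (commRingVal N))) (homOfLE h).op
    ((m : (commRingVal M).obj (op U)) ⊗ₜ[Γ(X, U)] (n : (commRingVal N).obj (op U)))
  exact this.symm

/-- The canonical map `M(U) ⊗ N(U) → (M ⊗ N)(U)`. -/
def tensorToSections (M N : X.Modules) (U : X.Opens) :
    Γ(M, U) ⊗[Γ(X, U)] Γ(N, U) →ₗ[Γ(X, U)] Γ(tensorSheaf M N, U) :=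
  TensorProduct.lift (LinearMap.mk₂ _ (tensorSections M N U) (tensorSections_add_left M N U)
    (tensorSections_smul_left M N U) (tensorSections_add_right M N U)
    (tensorSections_smul_right M N U))

lemma tensorToSections_eq_toSheafify (M N : X.Modules) (U : X.Opens)
    (t : Γ(M, U) ⊗[Γ(X, U)] Γ(N, U)) :
    tensorToSections M N U t = (toSheafify (Opens.grothendieckTopology X)
      (PresheafOfModules.Monoidal.tensorObj (commRingVal M) (commRingVal N)).presheaf).app (op U) t := by
  induction t with
  | zero => exact (map_zero _).trans (map_zero _).symm
  | tmul m n => rfl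
  | add t t' h h' => exact (map_add _ _ _).trans ((congrArg₂ _ h h').trans (map_add _ _ _).symm)

/-- The map from a presheaf to its sheafification is locally surjective. -/
lemma exists_res_eq_tensorToSections (M N : X.Modules) {U : X.Opens} (n : Γ(tensorSheaf M N, U))
    {x : X} (hx : x ∈ U) : ∃ (V : X.Opens) (h : V ≤ U), x ∈ V ∧ ∃ t : Γ(M, V) ⊗[Γ(X, V)] Γ(N, V),
      sectionRes _ h n = tensorToSections M N V t := by
  obtain ⟨V, f, ⟨t, ht⟩, hxV⟩ := Presheaf.imageSieve_mem (Opens.grothendieckTopology X)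
    (toSheafify (Opens.grothendieckTopology X)
      (PresheafOfModules.Monoidal.tensorObj (commRingVal M) (commRingVal N)).presheaf)
    (U := op U) n x hx
  refine ⟨V, leOfHom f, hxV, t, ?_⟩
  exact ht.symm.trans (tensorToSections_eq_toSheafify M N V t).symm

/-- The map from a presheaf to its sheafification is locally injective. -/
lemma exists_tmul_eq_zero (M N : X.Modules) {U : X.Opens} (m : Γ(M, U)) (n : Γ(N, U))
    (h0 : tensorSections M N U m n = 0) {x : X} (hx : x ∈ U) :
    ∃ (V : X.Opens) (h : V ≤ U), x ∈ V ∧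
      sectionRes M h m ⊗ₜ[Γ(X, V)] sectionRes N h n = 0 := by
  obtain ⟨V, f, hf, hxV⟩ := Presheaf.equalizerSieve_mem (Opens.grothendieckTopology X)
    (toSheafify (Opens.grothendieckTopology X)
      (PresheafOfModules.Monoidal.tensorObj (commRingVal M) (commRingVal N)).presheaf)
    (X := op U) ((m : (commRingVal M).obj (op U)) ⊗ₜ[Γ(X, U)] (n : (commRingVal N).obj (op U))) 0
    (h0.trans (map_zero _).symm) x hx
  exact ⟨V, leOfHom f, hxV, hf.trans (map_zero _)⟩

/-- A section that freely generates `M` over `U`. -/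
def IsGenerator (M : X.Modules) (U : X.Opens) (e : Γ(M, U)) : Prop :=
  ∀ (V : X.Opens) (h : V ≤ U), Function.Bijective fun a : Γ(X, V) => a • sectionRes M h e

lemma IsGenerator.res {M : X.Modules} {U : X.Opens} {e : Γ(M, U)} (he : IsGenerator M U e)
    {V : X.Opens} (h : V ≤ U) : IsGenerator M V (sectionRes M h e) := by
  intro W hW
  rw [sectionRes_sectionRes]
  exact he W (hW.trans h)

lemma IsGenerator.exists_smul {M : X.Modules} {U : X.Opens} {e : Γ(M, U)} (he : IsGenerator M U e)
    (m : Γ(M, U)) : ∃ a : Γ(X, U), m = a • e := by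
  obtain ⟨a, ha⟩ := (he U le_rfl).2 m
  exact ⟨a, by rw [← ha]; simp [sectionRes_self]⟩

lemma IsGenerator.eq_zero {M : X.Modules} {U : X.Opens} {e : Γ(M, U)} (he : IsGenerator M U e)
    {a : Γ(X, U)} (h : a • e = 0) : a = 0 := by
  refine (he U le_rfl).1 ?_
  simp [sectionRes_self, h]

lemma IsLineBundle.exists_isGenerator {M : X.Modules} (hM : IsLineBundle M) (x : X) :
    ∃ U : X.Opens, x ∈ U ∧ ∃ e, IsGenerator M U e := by
  obtain ⟨U, hxU, ⟨α⟩⟩ := hM x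
  let e₀ : Γ(M, U.ι ''ᵁ ⊤) := α.inv.app ⊤ (1 : Γ(U.toScheme, ⊤))
  have hU : U ≤ U.ι ''ᵁ ⊤ := by simp
  refine ⟨U, hxU, sectionRes M hU e₀, fun V hV => ?_⟩
  -- The trivialization lives on the scheme `U`, so an open subset of `X` inside `U` is rewritten as
  -- the image of an open subset of that scheme.
  obtain ⟨V', rfl⟩ : ∃ V', V = U.ι ''ᵁ V' := ⟨U.ι ⁻¹ᵁ V, by
    rw [Scheme.Hom.image_preimage_eq_opensRange_inf, Scheme.Opens.opensRange_ι, inf_eq_right.2 hV]⟩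
  rw [sectionRes_sectionRes]
  have h1 : ∀ r : Γ(U.toScheme, V'), α.inv.app V' r =
      (U.ι.appIso V').inv r • sectionRes M (hV.trans hU) e₀ := by
    intro r
    have h2 : (show Γ(structureSheaf U.toScheme, V') from r) =
        r • (show Γ(structureSheaf U.toScheme, V') from (1 : Γ(U.toScheme, V'))) :=
      (mul_one r).symm
    have h3 : (show Γ(structureSheaf U.toScheme, V') from (1 : Γ(U.toScheme, V'))) =
        sectionRes (structureSheaf U.toScheme) le_top (1 : Γ(U.toScheme, ⊤)) :=
      (map_one (U.toScheme.presheaf.map (homOfLE (le_top : V' ≤ ⊤)).op).hom).symm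
    have h4 := congr($(α.inv.mapPresheaf.naturality (homOfLE (le_top : V' ≤ ⊤)).op).hom
      (1 : Γ(U.toScheme, ⊤)))
    refine (congrArg (α.inv.app V') h2).trans ((Scheme.Modules.Hom.app_smul α.inv r _).trans ?_)
    rw [h3]
    exact congrArg (fun m : Γ(M, U.ι ''ᵁ V') => (U.ι.appIso V').inv r • m) h4
  -- Multiplication by the image of `1` is a composite of two isomorphisms.
  have h5 : (fun a : Γ(X, U.ι ''ᵁ V') => a • sectionRes M (hV.trans hU) e₀) =
      α.inv.app V' ∘ (U.ι.appIso V').hom := by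
    funext a
    refine .trans ?_ (h1 _).symm
    rw [← CommRingCat.comp_apply, Iso.hom_inv_id]
    rfl
  rw [h5]
  refine Function.Bijective.comp ?_ ?_
  · exact ConcreteCategory.bijective_of_isIso (α.inv.app V')
  · exact ConcreteCategory.bijective_of_isIso (U.ι.appIso V').hom

lemma homSections_res {M N : X.Modules} {U : X.Opens} (φ : homSections M N U)
    {V W : X.Opens} (hV : V ≤ U) (h : W ≤ V) (m : Γ(M, V)) :
    sectionRes N h (φ.1 ⟨V, hV⟩ m) = φ.1 ⟨W, h.trans hV⟩ (sectionRes M h m) :=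
  (φ.2 ⟨V, hV⟩ ⟨W, h.trans hV⟩ h m).symm

lemma homSections_app_smul {M N : X.Modules} {U : X.Opens} (φ : homSections M N U)
    {V : X.Opens} (hV : V ≤ U) (a : Γ(X, V)) (m : Γ(M, V)) :
    φ.1 ⟨V, hV⟩ (a • m) = a • (φ.1 ⟨V, hV⟩ m) :=
  (φ.1 ⟨V, hV⟩).map_smul a m

lemma tensorSections_zero_right (M N : X.Modules) {U : X.Opens} (m : Γ(M, U)) :
    tensorSections M N U m 0 = 0 := by
  simpa using tensorSections_add_right M N U m 0 0

/-- A common trivialization of two line bundles. -/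
lemma IsLineBundle.exists_isGenerator₂ {L M : X.Modules} (hL : IsLineBundle L)
    (hM : IsLineBundle M) {V : X.Opens} {x : X} (hx : x ∈ V) :
    ∃ (U : X.Opens), U ≤ V ∧ x ∈ U ∧ ∃ e f, IsGenerator M U e ∧ IsGenerator L U f := by
  obtain ⟨U₁, hx₁, e, he⟩ := hM.exists_isGenerator x
  obtain ⟨U₂, hx₂, f, hf⟩ := hL.exists_isGenerator x
  exact ⟨V ⊓ (U₁ ⊓ U₂), inf_le_left, ⟨hx, hx₁, hx₂⟩, _, _,
    he.res (inf_le_right.trans inf_le_left), hf.res (inf_le_right.trans inf_le_right)⟩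

/-- The homomorphism dual to a generator. -/
lemma IsGenerator.exists_dual {M : X.Modules} {U : X.Opens} {e : Γ(M, U)}
    (he : IsGenerator M U e) :
    ∃ δ : homSections M (structureSheaf X) U, ∀ ψ : homSections M (structureSheaf X) U,
      ψ = asFunction (ψ.1 ⟨U, le_rfl⟩ e) • δ := by
  let E (V : {V : X.Opens // V ≤ U}) : Γ(X, V.1) ≃ₗ[Γ(X, V.1)] Γ(M, V.1) :=
    LinearEquiv.ofBijective (LinearMap.toSpanSingleton Γ(X, V.1) Γ(M, V.1) (sectionRes M V.2 e))
      (he V.1 V.2)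
  have hE : ∀ V a, E V a = a • sectionRes M V.2 e := fun _ _ => rfl
  let δ : homSections M (structureSheaf X) U := ⟨fun V =>
      { toFun := fun m => ((E V).symm m : Γ(X, V.1))
        map_add' := fun m m' => (E V).symm.map_add m m'
        map_smul' := fun a m => (E V).symm.map_smul a m }, by
    intro V W h m
    obtain ⟨a, rfl⟩ := (E V).surjective m
    have h1 : sectionRes M h (E V a) = E W (functionRes h a) := by
      rw [hE, hE, sectionRes_smul, sectionRes_sectionRes]
    change (E W).symm (sectionRes M h (E V a)) = functionRes h ((E V).symm (E V a))
    rw [h1, LinearEquiv.symm_apply_apply, LinearEquiv.symm_apply_apply]⟩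
  refine ⟨δ, fun ψ => ?_⟩
  ext V m
  obtain ⟨a, rfl⟩ := (E V).surjective m
  have h2 : δ.1 V (E V a) = a := (E V).symm_apply_apply a
  rw [homSections_smul_val, LinearMap.smul_apply, h2, hE, map_smul,
    ← homSections_res ψ le_rfl V.2 e]
  exact mul_comm a (asFunction (sectionRes (structureSheaf X) V.2 (ψ.1 ⟨U, le_rfl⟩ e)))

lemma IsGenerator.homSections_ext {M N : X.Modules} {U : X.Opens} {e : Γ(M, U)}
    (he : IsGenerator M U e) (φ ψ : homSections M N U)
    (h : φ.1 ⟨U, le_rfl⟩ e = ψ.1 ⟨U, le_rfl⟩ e) : φ = ψ := by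
  ext V m
  obtain ⟨a, rfl⟩ := (he V.1 V.2).2 m
  simp only [map_smul]
  rw [← homSections_res φ le_rfl V.2 e, h, homSections_res]

lemma exists_tensorToSections_eq {L N : X.Modules} {U : X.Opens} {f : Γ(L, U)}
    (hf : IsGenerator L U f) (t : Γ(L, U) ⊗[Γ(X, U)] Γ(N, U)) :
    ∃ ψ : Γ(N, U), tensorToSections L N U t = tensorSections L N U f ψ := by
  suffices h : ∃ ψ : Γ(N, U), t = f ⊗ₜ ψ by
    obtain ⟨ψ, rfl⟩ := h
    exact ⟨ψ, rfl⟩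
  induction t with
  | zero => exact ⟨0, (TensorProduct.tmul_zero _ _).symm⟩
  | tmul l n =>
    obtain ⟨a, rfl⟩ := hf.exists_smul l
    exact ⟨a • n, TensorProduct.smul_tmul _ _ _⟩
  | add t t' h h' =>
    obtain ⟨ψ, rfl⟩ := h
    obtain ⟨ψ', rfl⟩ := h'
    exact ⟨ψ + ψ', (TensorProduct.tmul_add _ _ _).symm⟩

lemma exists_res_eq_tensorSections {L : X.Modules} (N : X.Modules) {U : X.Opens} {f : Γ(L, U)}
    (hf : IsGenerator L U f) (n : Γ(tensorSheaf L N, U)) {x : X} (hx : x ∈ U) :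
    ∃ (V : X.Opens) (h : V ≤ U), x ∈ V ∧ ∃ ψ : Γ(N, V),
      sectionRes _ h n = tensorSections L N V (sectionRes L h f) ψ := by
  obtain ⟨V, h, hxV, t, ht⟩ := exists_res_eq_tensorToSections L N n hx
  obtain ⟨ψ, hψ⟩ := exists_tensorToSections_eq (hf.res h) t
  exact ⟨V, h, hxV, ψ, ht.trans hψ⟩

lemma functionRes_eq_zero {U V : X.Opens} [IsIntegral X] (h : V ≤ U) {x : X} (hx : x ∈ V)
    {a : Γ(X, U)} (ha : functionRes h a = 0) : a = 0 := by
  have : Nonempty V := ⟨⟨x, hx⟩⟩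
  exact map_injective_of_isIntegral X (homOfLE h) (ha.trans (map_zero _).symm)

/-- Locally the relation already holds in the presheaf tensor product, which the generators identify
with `𝒪 ⊗ 𝒪 = 𝒪`. So `a` vanishes near `x`, hence everywhere by integrality. -/
lemma eq_zero_of_smul_tensorSections_eq_zero [IsIntegral X] {L M : X.Modules} {U : X.Opens}
    {f : Γ(L, U)} {e : Γ(M, U)} (hf : IsGenerator L U f) (he : IsGenerator M U e) {x : X}
    (hx : x ∈ U) {a : Γ(X, U)} (ha : a • tensorSections L M U f e = 0) : a = 0 := by
  rw [← tensorSections_smul_left] at ha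
  obtain ⟨V, h, hxV, hV⟩ := exists_tmul_eq_zero L M _ _ ha hx
  refine functionRes_eq_zero h hxV ?_
  let F : Γ(X, V) ≃ₗ[Γ(X, V)] Γ(L, V) := LinearEquiv.ofBijective
    (LinearMap.toSpanSingleton _ _ (sectionRes L h f)) (hf V h)
  let E : Γ(X, V) ≃ₗ[Γ(X, V)] Γ(M, V) := LinearEquiv.ofBijective
    (LinearMap.toSpanSingleton _ _ (sectionRes M h e)) (he V h)
  have hF : sectionRes L h (a • f) = F (functionRes h a) := sectionRes_smul _ _ _ _
  have hE : sectionRes M h e = E 1 := (one_smul _ _).symm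
  rw [hF, hE] at hV
  have := congrArg (TensorProduct.lid Γ(X, V) Γ(X, V) ∘ TensorProduct.congr F.symm E.symm) hV
  simpa using this

/-! ### Multiplying sections of `L ⊗ M^∨` and of `M` -/

/-- The homomorphism `M → L` defined by a section of `L ⊗ M^∨`. -/
def sectionHom (L M : X.Modules) {U : X.Opens} (n : Γ(tensorSheaf L (dualSheaf M), U)) :
    homSections M L U := (contraction L M).app U n

lemma sectionHom_res (L M : X.Modules) {U V W : X.Opens} (h : V ≤ U)
    (n : Γ(tensorSheaf L (dualSheaf M), U)) (hW : W ≤ V) (m : Γ(M, W)) :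
    (sectionHom L M (sectionRes _ h n)).1 ⟨W, hW⟩ m = (sectionHom L M n).1 ⟨W, hW.trans h⟩ m := by
  have h1 : sectionHom L M (sectionRes _ h n) = homRes M L h (sectionHom L M n) :=
    congr($((contraction L M).mapPresheaf.naturality (homOfLE h).op).hom n)
  rw [h1]
  rfl

lemma sectionHom_tensorSections (L M : X.Modules) {U : X.Opens} (l : Γ(L, U))
    (ψ : homSections M (structureSheaf X) U) (m : Γ(M, U)) :
    (sectionHom L M (tensorSections L (dualSheaf M) U l ψ)).1 ⟨U, le_rfl⟩ m =
      asFunction (ψ.1 ⟨U, le_rfl⟩ m) • l := by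
  rw [sectionHom, contraction_tensorSections]
  exact congrArg (asFunction (ψ.1 ⟨U, le_rfl⟩ m) • ·) (sectionRes_self L _ l)

/-- Locally the section is `f ⊗ ψ` with `f` a generator of `L`, and it sends a generator `e` of `M`
to `ψ(e) f`. If this is zero, so are `ψ(e)` and `ψ`. -/
lemma sectionHom_injective {L M : X.Modules} (hL : IsLineBundle L) (hM : IsLineBundle M)
    {U : X.Opens} (n : Γ(tensorSheaf L (dualSheaf M), U))
    (h : ∀ (V : X.Opens) (hV : V ≤ U) m, (sectionHom L M n).1 ⟨V, hV⟩ m = 0) : n = 0 := by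
  refine section_ext _ _ _ fun x hx => ?_
  obtain ⟨V, hV, hxV, e, f, he, hf⟩ := hL.exists_isGenerator₂ hM hx
  obtain ⟨W, hW, hxW, ψ, hψ⟩ := exists_res_eq_tensorSections (dualSheaf M) hf (sectionRes _ hV n) hxV
  rw [sectionRes_sectionRes] at hψ
  refine ⟨W, hW.trans hV, hxW, ?_⟩
  have h1 := sectionHom_tensorSections L M (sectionRes L hW f) ψ (sectionRes M hW e)
  rw [← hψ, sectionHom_res, h] at h1
  have h2 : ψ = (0 : homSections M (structureSheaf X) W) :=
    (he.res hW).homSections_ext _ _ ((hf.res hW).eq_zero h1.symm)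
  rw [hψ, h2, map_zero]
  exact tensorSections_zero_right L (dualSheaf M) _

/-- A section of a line bundle on an integral scheme is zero if it is zero on a nonempty open set. -/
lemma IsLineBundle.eq_zero_of_res_eq_zero [IsIntegral X] {M : X.Modules} (hM : IsLineBundle M)
    {U V : X.Opens} (h : V ≤ U) {x : X} (hx : x ∈ V) {m : Γ(M, U)} (hm : sectionRes M h m = 0) :
    m = 0 := by
  refine section_ext _ _ _ fun y hy => ?_
  obtain ⟨W, hW, hyW, e, -, he, -⟩ := hM.exists_isGenerator₂ hM hy
  refine ⟨W, hW, hyW, ?_⟩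
  obtain ⟨a, ha⟩ := he.exists_smul (sectionRes M hW m)
  obtain ⟨z, hzV, hzW⟩ : ((V : Set X) ∩ W).Nonempty :=
    nonempty_preirreducible_inter V.isOpen W.isOpen ⟨x, hx⟩ ⟨y, hyW⟩
  have ha0 : functionRes (inf_le_right : V ⊓ W ≤ W) a = 0 := by
    refine (he.res inf_le_right).eq_zero ?_
    rw [← sectionRes_smul, ← ha, sectionRes_sectionRes,
      ← sectionRes_sectionRes M h (inf_le_left : V ⊓ W ≤ V), hm, map_zero]
  rw [ha, functionRes_eq_zero inf_le_right (x := z) ⟨hzV, hzW⟩ ha0, zero_smul, map_zero]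

lemma sectionHom_eq_zero_of_apply_eq_zero [IsIntegral X] {L M : X.Modules} (hL : IsLineBundle L)
    (hM : IsLineBundle M) (n : Γ(tensorSheaf L (dualSheaf M), ⊤)) {s : Γ(M, ⊤)} (hs : s ≠ 0)
    (h : (sectionHom L M n).1 ⟨⊤, le_rfl⟩ s = 0) : n = 0 := by
  refine sectionHom_injective hL hM n fun V hV m => section_ext _ _ _ fun x hx => ?_
  obtain ⟨W, hW, hxW, e, f, he, hf⟩ := hL.exists_isGenerator₂ hM hx
  have : Nonempty W := ⟨⟨x, hxW⟩⟩
  obtain ⟨g, hg⟩ := he.exists_smul (sectionRes M le_top s)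
  obtain ⟨a, ha⟩ := hf.exists_smul ((sectionHom L M n).1 ⟨W, le_top⟩ e)
  have hg0 : g ≠ 0 := by
    rintro rfl
    rw [zero_smul] at hg
    exact hs (hM.eq_zero_of_res_eq_zero _ hxW hg)
  have h1 := congrArg (sectionRes L (le_top : W ≤ ⊤)) h
  rw [homSections_res, hg, homSections_app_smul, ha, map_zero, ← mul_smul] at h1
  have ha0 : a = 0 := (mul_eq_zero.1 (hf.eq_zero h1)).resolve_left hg0
  refine ⟨W, hW, hxW, ?_⟩
  obtain ⟨c, hc⟩ := he.exists_smul (sectionRes M hW m)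
  rw [homSections_res, hc, homSections_app_smul, ha, ha0, zero_smul, smul_zero, map_zero]

/-- Near every point, some section of a base-point free `L ⊗ M^∨` is an isomorphism `M → L`. -/
lemma exists_sectionHom_isUnit {L M : X.Modules} (hL : IsLineBundle L) (hM : IsLineBundle M)
    (hbpf : IsBasePointFree (tensorSheaf L (dualSheaf M))) {U : X.Opens} {x : X} (hx : x ∈ U) :
    ∃ (n : Γ(tensorSheaf L (dualSheaf M), ⊤)) (V : X.Opens), V ≤ U ∧ x ∈ V ∧
      ∃ (e : Γ(M, V)) (f : Γ(L, V)) (u : Γ(X, V)), IsGenerator M V e ∧ IsGenerator L V f ∧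
        IsUnit u ∧ (sectionHom L M n).1 ⟨V, le_top⟩ e = u • f := by
  obtain ⟨n, hn⟩ := hbpf x
  obtain ⟨U', hU', hxU, e, f, he, hf⟩ := hL.exists_isGenerator₂ hM hx
  obtain ⟨V, hV, hxV, ψ, hψ⟩ :=
    exists_res_eq_tensorSections (dualSheaf M) hf (sectionRes _ le_top n) hxU
  rw [sectionRes_sectionRes] at hψ
  replace he := he.res hV
  replace hf := hf.res hV
  obtain ⟨δ, hδ⟩ := he.exists_dual
  let u : Γ(X, V) := asFunction (Subtype.val (p := (· ∈ homSections M (structureSheaf X) V)) ψ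
    ⟨V, le_rfl⟩ (sectionRes M hV e))
  have hu : IsUnit (X.presheaf.germ V x hxV u) := by
    -- Here `n = u · (f ⊗ δ)` near `x`, with `δ` dual to the generator of `M`. A non-unit germ of
    -- `u` would put the germ of `n` in `𝔪_x` times the stalk, making `x` a base point for `n`.
    by_contra hu
    refine hn ?_
    have h1 : sectionRes _ le_top n =
        u • tensorSections L (dualSheaf M) V (sectionRes L hV f) δ :=
      hψ.trans ((congrArg (tensorSections L (dualSheaf M) V (sectionRes L hV f)) (hδ ψ)).trans
        (tensorSections_smul_right L (dualSheaf M) V u _ δ))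
    have h2 : (tensorSheaf L (dualSheaf M)).presheaf.germ ⊤ x trivial n =
        X.presheaf.germ V x hxV u • (tensorSheaf L (dualSheaf M)).presheaf.germ V x hxV
          (tensorSections L (dualSheaf M) V (sectionRes L hV f) δ) := by
      refine .trans ?_ (PresheafOfModules.germ_smul (commRingVal (tensorSheaf L (dualSheaf M))) x V
        hxV u _)
      refine .trans ?_ (congrArg _ h1)
      exact (TopCat.Presheaf.germ_res_apply _ (homOfLE le_top) x hxV n).symm
    rw [h2]
    exact Submodule.smul_mem_smul ((IsLocalRing.mem_maximalIdeal _).2 hu) trivial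
  refine ⟨n, X.basicOpen u, (X.basicOpen_le u).trans (hV.trans hU'), (X.mem_basicOpen u x hxV).2 hu,
    sectionRes M (X.basicOpen_le u) (sectionRes M hV e),
    sectionRes L (X.basicOpen_le u) (sectionRes L hV f), functionRes (X.basicOpen_le u) u,
    he.res _, hf.res _, RingedSpace.isUnit_res_basicOpen _ u, ?_⟩
  have h1 := sectionHom_tensorSections L M (sectionRes L hV f) ψ (sectionRes M hV e)
  rw [← hψ, sectionHom_res] at h1
  rw [← homSections_res _ le_top, h1, sectionRes_smul]

lemma homSections_res_eq_smul {L M : X.Modules} {U V W : X.Opens} (φ : homSections M L U)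
    (hV : V ≤ U) (hW : W ≤ V) {m : Γ(M, V)} {e : Γ(M, W)} {f : Γ(L, W)} {g a : Γ(X, W)}
    (hm : sectionRes M hW m = g • e) (he : φ.1 ⟨W, hW.trans hV⟩ e = a • f) :
    sectionRes L hW (φ.1 ⟨V, hV⟩ m) = (g * a) • f := by
  rw [homSections_res, hm, homSections_app_smul, he, mul_smul]

/-- Near each point some `n` carries a generator of `M` to a unit times a generator of `L`, so that
single `n` already separates sections there. This also makes local candidates for a section of `M`
glue. -/
lemma eq_of_forall_sectionHom_eq {L M : X.Modules} (hL : IsLineBundle L) (hM : IsLineBundle M)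
    (hbpf : IsBasePointFree (tensorSheaf L (dualSheaf M))) {U : X.Opens} (m m' : Γ(M, U))
    (h : ∀ n : Γ(tensorSheaf L (dualSheaf M), ⊤),
      (sectionHom L M n).1 ⟨U, le_top⟩ m = (sectionHom L M n).1 ⟨U, le_top⟩ m') : m = m' := by
  refine section_ext _ _ _ fun x hx => ?_
  obtain ⟨n, V, hV, hxV, e, f, u, he, hf, hu, hn⟩ := exists_sectionHom_isUnit hL hM hbpf hx
  refine ⟨V, hV, hxV, ?_⟩
  obtain ⟨c, hc⟩ := he.exists_smul (sectionRes M hV m)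
  obtain ⟨c', hc'⟩ := he.exists_smul (sectionRes M hV m')
  have h1 := congrArg (sectionRes L hV) (h n)
  rw [homSections_res, homSections_res, hc, hc', homSections_app_smul, homSections_app_smul, hn,
    ← mul_smul, ← mul_smul, ← sub_eq_zero, ← sub_smul] at h1
  rw [hc, hc', hu.mul_right_cancel (sub_eq_zero.1 (hf.eq_zero h1))]

/-- In local generators both sides are the same product of four functions times `f ⊗ f`. -/
lemma tensorSections_sectionHom_comm [IsIntegral X] {L M : X.Modules} (hL : IsLineBundle L)
    (hM : IsLineBundle M) (n n' : Γ(tensorSheaf L (dualSheaf M), ⊤)) (m m' : Γ(M, ⊤)) :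
    tensorSections L L ⊤ ((sectionHom L M n).1 ⟨⊤, le_rfl⟩ m)
        ((sectionHom L M n').1 ⟨⊤, le_rfl⟩ m') =
      tensorSections L L ⊤ ((sectionHom L M n').1 ⟨⊤, le_rfl⟩ m)
        ((sectionHom L M n).1 ⟨⊤, le_rfl⟩ m') := by
  refine section_ext _ _ _ fun x hx => ?_
  obtain ⟨V, hV, hxV, e, f, he, hf⟩ := hL.exists_isGenerator₂ hM hx
  refine ⟨V, hV, hxV, ?_⟩
  obtain ⟨g, hg⟩ := he.exists_smul (sectionRes M hV m)
  obtain ⟨c, hc⟩ := he.exists_smul (sectionRes M hV m')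
  obtain ⟨a, ha⟩ := hf.exists_smul ((sectionHom L M n).1 ⟨V, le_top⟩ e)
  obtain ⟨b, hb⟩ := hf.exists_smul ((sectionHom L M n').1 ⟨V, le_top⟩ e)
  rw [tensorSections_res, tensorSections_res, homSections_res_eq_smul _ _ hV hg ha,
    homSections_res_eq_smul _ _ hV hc hb, homSections_res_eq_smul _ _ hV hg hb,
    homSections_res_eq_smul _ _ hV hc ha]
  simp only [tensorSections_smul_left, tensorSections_smul_right, ← mul_smul]
  congr 1
  ring

/-- A family of sections `l n` of `L`, for `n ∈ H⁰(L ⊗ M^∨)`, such that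
`(n s) (l n') = (n' s) (l n)`, comes from a section of `M`. -/
lemma exists_sectionHom_eq [IsIntegral X] {L M : X.Modules} (hL : IsLineBundle L)
    (hM : IsLineBundle M) (hbpf : IsBasePointFree (tensorSheaf L (dualSheaf M))) {s : Γ(M, ⊤)}
    (hs : s ≠ 0) (l : Γ(tensorSheaf L (dualSheaf M), ⊤) → Γ(L, ⊤))
    (hl : ∀ n n', tensorSections L L ⊤ ((sectionHom L M n).1 ⟨⊤, le_rfl⟩ s) (l n') =
      tensorSections L L ⊤ ((sectionHom L M n').1 ⟨⊤, le_rfl⟩ s) (l n)) :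
    ∃ m : Γ(M, ⊤), ∀ n, l n = (sectionHom L M n).1 ⟨⊤, le_rfl⟩ m := by
  have key : ∀ x : X, ∃ V : X.Opens, x ∈ V ∧ ∃ m : Γ(M, V), ∀ n,
      sectionRes L le_top (l n) = (sectionHom L M n).1 ⟨V, le_top⟩ m := by
    intro x
    obtain ⟨n, V, -, hxV, e, f, u, he, hf, hu, hn⟩ :=
      exists_sectionHom_isUnit hL hM hbpf (U := ⊤) (x := x) trivial
    have : Nonempty V := ⟨⟨x, hxV⟩⟩
    obtain ⟨v, hv⟩ := hu.exists_right_inv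
    obtain ⟨b, hb⟩ := hf.exists_smul (sectionRes L le_top (l n))
    obtain ⟨g, hg⟩ := he.exists_smul (sectionRes M le_top s)
    have hg0 : g ≠ 0 := by
      rintro rfl
      rw [zero_smul] at hg
      exact hs (hM.eq_zero_of_res_eq_zero _ hxV hg)
    -- This is the quotient `l(n)/n`, where `n` acts on generators as the unit `u` with inverse `v`.
    -- The symmetry relation, after cancelling the nonzero function `g` that represents `s`, shows
    -- that it works for every `n'`.
    refine ⟨V, hxV, (v * b) • e, fun n' => ?_⟩
    obtain ⟨a, ha⟩ := hf.exists_smul ((sectionHom L M n').1 ⟨V, le_top⟩ e)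
    obtain ⟨b', hb'⟩ := hf.exists_smul (sectionRes L le_top (l n'))
    have h1 := congrArg (sectionRes _ (le_top : V ≤ ⊤)) (hl n n')
    rw [tensorSections_res, tensorSections_res, homSections_res_eq_smul _ _ le_top hg hn,
      homSections_res_eq_smul _ _ le_top hg ha, hb, hb'] at h1
    simp only [tensorSections_smul_left, tensorSections_smul_right, ← mul_smul] at h1
    rw [← sub_eq_zero, ← sub_smul] at h1
    have h2 := eq_zero_of_smul_tensorSections_eq_zero hf hf hxV h1
    have h3 : g * (u * b' - a * b) = 0 := by linear_combination h2
    have h4 := (mul_eq_zero.1 h3).resolve_left hg0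
    rw [hb', homSections_app_smul, ha, ← mul_smul]
    congr 1
    linear_combination v * h4 - b' * hv
  choose V hxV m hm using key
  obtain ⟨m₀, hm₀, -⟩ := existsUnique_glue M V ⊤ (fun x => le_top)
    (fun x _ => Opens.mem_iSup.2 ⟨x, hxV x⟩) m fun x y => by
      refine eq_of_forall_sectionHom_eq hL hM hbpf _ _ fun n => ?_
      rw [← homSections_res _ le_top, ← homSections_res _ le_top, ← hm, ← hm, sectionRes_sectionRes,
        sectionRes_sectionRes]
  refine ⟨m₀, fun n => section_ext _ _ _ fun x _ => ⟨V x, le_top, hxV x, ?_⟩⟩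
  rw [hm, homSections_res, hm₀]

/-! ### Global functions are constant, and the conclusion -/

variable [X.Over SpecC]

/-- If `s ≠ 0` and `H⁰(M)` is finite-dimensional, then every global function is constant. -/
lemma scalars_surjective [IsIntegral X] {M : X.Modules} (hM : IsLineBundle M)
    [Module.Finite ℂ (H0 M)] {s : H0 M} (hs : s ≠ 0) : Function.Surjective (scalars X) := by
  let : Algebra ℂ Γ(X, ⊤) := (scalars X).toAlgebra
  let F : Γ(X, ⊤) →ₗ[ℂ] H0 M :=
    { toFun := fun a => a • s
      map_add' := fun a b => add_smul a b s
      map_smul' := fun c a => mul_smul (scalars X c) a s }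
  have hF : Function.Injective F := by
    refine (injective_iff_map_eq_zero F).2 fun a ha => ?_
    obtain ⟨x⟩ := (inferInstance : Nonempty X)
    obtain ⟨V, hxV, e, he⟩ := hM.exists_isGenerator x
    have : Nonempty V := ⟨⟨x, hxV⟩⟩
    obtain ⟨g, hg⟩ := he.exists_smul (sectionRes M le_top s)
    have hg0 : g ≠ 0 := by
      rintro rfl
      rw [zero_smul] at hg
      exact hs (hM.eq_zero_of_res_eq_zero _ hxV hg)
    have h1 : sectionRes M (le_top : V ≤ ⊤) (a • (show Γ(M, ⊤) from s)) = 0 :=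
      (congrArg (sectionRes M le_top) ha).trans (map_zero _)
    rw [sectionRes_smul, hg, ← mul_smul] at h1
    exact functionRes_eq_zero le_top hxV ((mul_eq_zero.1 (he.eq_zero h1)).resolve_right hg0)
  -- Since `a ↦ a s` embeds the global functions in `H⁰(M)`, they form a domain finite over the
  -- algebraically closed field `ℂ`.
  have : Module.Finite ℂ Γ(X, ⊤) := Module.Finite.of_injective F hF
  have : Algebra.IsIntegral ℂ Γ(X, ⊤) := inferInstance
  exact (IsAlgClosed.algebraMap_bijective_of_isIntegral (k := ℂ) (K := Γ(X, ⊤))).2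

lemma mulBySection_injective [IsIntegral X] {L M : X.Modules} (hL : IsLineBundle L)
    (hM : IsLineBundle M) {s : H0 M} (hs : s ≠ 0) : Function.Injective (mulBySection L M s) :=
  (injective_iff_map_eq_zero _).2 fun n hn => sectionHom_eq_zero_of_apply_eq_zero hL hM n hs hn

end SyzygyBundles

end

open SyzygyBundles
theorem mainTheorem3 (X : Scheme.{0}) [X.Over SpecC] [IsIntegral X] (hX : IsProjectiveOverC X)
    (L M : X.Modules) (hL : IsLineBundle L) (hM : IsLineBundle M) (p : ℕ)
    (hM2 : Module.finrank ℂ (H0 M) = 2)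
    (hN : Module.finrank ℂ (H0 (tensorSheaf L (dualSheaf M))) = p + 1)
    (hbpf : IsBasePointFree (tensorSheaf L (dualSheaf M)))
    (s : H0 M) (hs : s ≠ 0) :
    Function.Injective (mulBySection L M s) ∧
    (∃ e : ((⋀[ℂ]^(p + 1) (H0 (tensorSheaf L (dualSheaf M)))) ⊗[ℂ] (H0 M ⧸ Submodule.span ℂ {s})) ≃ₗ[ℂ]
        SyzygySpace L (LinearMap.range (mulBySection L M s)) p,
      ∀ t : (⋀[ℂ]^(p + 1) (H0 (tensorSheaf L (dualSheaf M)))) ⊗[ℂ] H0 M,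
        ∃ h : syzygyMap L M s p t ∈ koszulCycles p
            (sectionMul L L ∘ₗ (LinearMap.range (mulBySection L M s)).subtype),
          e ((Submodule.span ℂ {s}).mkQ.lTensor _ t) =
            Submodule.Quotient.mk ⟨syzygyMap L M s p t, h⟩) ∧
    Module.finrank ℂ (SyzygySpace L (LinearMap.range (mulBySection L M s)) p) = 1 := by
  have hinj := mulBySection_injective (L := L) hL hM hs
  have : Module.Finite ℂ (H0 M) := Module.finite_of_finrank_pos (by omega)
  have hfin : Module.Finite ℂ (H0 (tensorSheaf L (dualSheaf M))) :=
    Module.finite_of_finrank_pos (by omega)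
  let σ : H0 (tensorSheaf L (dualSheaf M)) ≃ₗ[ℂ] LinearMap.range (mulBySection L M s) :=
    LinearEquiv.ofInjective _ hinj
  -- The algebra is applied to `W = s · H⁰(L ⊗ M^∨)`, so the product is transported along `σ`; then
  -- `μ(·, s)` is the inclusion of `W` in `H⁰(L)`.
  let μ := contractionMul L M ∘ₗ σ.symm.toLinearMap
  have hμσ : ∀ n m, μ (σ n) m = contractionMul L M n m := fun n m =>
    congrArg (fun n => contractionMul L M n m) (σ.symm_apply_apply n)
  have hμs : ∀ w, μ w s = w.1 := by
    intro w
    obtain ⟨n, rfl⟩ := σ.surjective w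
    exact hμσ n s
  obtain ⟨e, he⟩ := exists_equiv_koszulCohomology p ((LinearEquiv.finrank_eq σ).symm.trans hN)
    (sectionSMul L ∘ₗ (LinearMap.range (mulBySection L M s)).subtype) μ
    (sectionMul L L ∘ₗ (LinearMap.range (mulBySection L M s)).subtype) s
    (by
      intro v w m
      obtain ⟨n, rfl⟩ := σ.surjective v
      obtain ⟨n', rfl⟩ := σ.surjective w
      rw [hμσ, hμσ]
      exact tensorSections_sectionHom_comm hL hM n n' s m)
    (by
      intro l hl
      obtain ⟨m, hm⟩ := exists_sectionHom_eq hL hM hbpf hs (fun n => l (σ n))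
        fun n n' => hl (σ n) (σ n')
      refine ⟨m, fun w => ?_⟩
      obtain ⟨n, rfl⟩ := σ.surjective w
      exact (hm n).trans (hμσ n m).symm)
    (by
      intro m hm
      refine eq_of_forall_sectionHom_eq hL hM hbpf m 0 fun n => ?_
      exact ((hμσ n m).symm.trans (hm (σ n))).trans (map_zero (contractionMul L M n)).symm)
    (by
      intro a
      obtain ⟨c, hc⟩ := scalars_surjective hM hs (asFunction a)
      refine ⟨c, fun w => ?_⟩
      rw [hμs, complex_smul_def, hc]
      rfl)
    ⟨(1 : Γ(X, ⊤)), fun w => (one_smul Γ(X, ⊤) w.1).trans (hμs w).symm⟩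
  have hσ : ∀ q, Function.Bijective (exteriorPower.map q σ.toLinearMap) := fun q =>
    ⟨exteriorPower.map_injective_field σ.injective,
      exteriorPower.map_surjective σ.surjective⟩
  -- Passing from `⋀^{p+1} W` back to `⋀^{p+1} H⁰(L ⊗ M^∨)` makes the explicit formula that of
  -- `syzygyMap`.
  let E := (LinearEquiv.ofBijective _ (hσ (p + 1))).rTensor (H0 M ⧸ Submodule.span ℂ {s}) ≪≫ₗ e
  have hE : ∀ t : (⋀[ℂ]^(p + 1) (H0 (tensorSheaf L (dualSheaf M)))) ⊗[ℂ] H0 M,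
      ∃ h : syzygyMap L M s p t ∈ koszulCycles p
          (sectionMul L L ∘ₗ (LinearMap.range (mulBySection L M s)).subtype),
        E ((Submodule.span ℂ {s}).mkQ.lTensor _ t) =
          Submodule.Quotient.mk ⟨syzygyMap L M s p t, h⟩ := by
    intro t
    obtain ⟨h, h'⟩ := he ((exteriorPower.map (p + 1) σ.toLinearMap).rTensor _ t)
    have h1 : koszulDifferential p μ ((exteriorPower.map (p + 1) σ.toLinearMap).rTensor _ t) =
        syzygyMap L M s p t := koszulDifferential_map p _ μ σ.toLinearMap hμσ t
    have h2 : E ((Submodule.span ℂ {s}).mkQ.lTensor _ t) = e ((Submodule.span ℂ {s}).mkQ.lTensor _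
        ((exteriorPower.map (p + 1) σ.toLinearMap).rTensor _ t)) := by
      refine congrArg e ?_
      exact LinearMap.congr_fun ((LinearMap.rTensor_comp_lTensor _ _ _).trans
        (LinearMap.lTensor_comp_rTensor _ _ _).symm) t
    refine ⟨h1 ▸ h, (h2.trans h').trans ?_⟩
    congr 2
  refine ⟨hinj, ⟨E, hE⟩, ?_⟩
  rw [← E.finrank_eq, Module.finrank_tensorProduct,
    finrank_topPower (Module.finBasisOfFinrankEq ℂ _ hN), one_mul]
  have := Submodule.finrank_quotient_add_finrank (Submodule.span ℂ {s})
  rw [hM2, finrank_span_singleton hs] at this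
  omega
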